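/- Let $G$ be a finite simple graph with a distinguished vertex $s$. Let $D$ be an unknown directed graph obtained by choosing a set of edges of $G$ and orienting each of them in one direction, such that every vertex has outdegree at most one and $s$ has indegree zero. In Setting 1, every vertex other than $s$ has indegree exactly one (so $D$ consists of a directed path starting at $s$ and of disjoint directed cycles, covering all vertices). In Setting 2, $D$ is a single directed path starting at $s$ (possibly of length zero; vertices off the path are isolated). Let $t$ denote the end of the directed path that starts at $s$. A query of type A at a vertex $v$ answers "$v=t$" if $v=t$; otherwise it answers the edge of $D$ going out of $v$, or, if there is none, that $v$ is not on the path. A query of type B at $v$ answers the set of edges of $D$ incident to $v$, with their directions. For $i\in\{1,2\}$ and $X\in\{A,B\}$ let $h_i^X(G)$ be the minimal number $q$ such that some adaptive deterministic algorithm, knowing $G$ and $s$, determines $t$ in Setting $i$ with at most $q$ queries of type $X$ for every admissible $D$. Let $G_d(n)$ be the grid graph on $\{0,1,\dots,n-1\}^d$, where two vertices are adjacent if they differ in exactly one coordinate and differ there by one, and let $s=(0,\dots,0)$. **Theorem.** For $d\ge 2$, the numbers $h_1^B(G_d(n))$, $h_2^A(G_d(n))$ and $h_2^B(G_d(n))$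 are all $O(n^{d-1})$ and $\Omega(n^{d-1}/d)$, with absolute implied constants. More precisely: 1. There is an absolute constant $C>0$ such that for all $d\ge 2$ and $n\ge 1$, each of $h_1^B(G_d(n))$, $h_2^A(G_d(n))$, $h_2^B(G_d(n))$ is at most $C\,n^{d-1}$. 2. For all $d\ge 1$ and $n\ge 2$, $h_2^B(G_d(n))\ge \dfrac{n^{d-1}}{3d}$ and $h_2^A(G_d(n))\ge \dfrac{n^{d-1}}{3d}$. 3. For all $d\ge 2$ and $n\ge 2$, $h_1^B(G_d(n))\ge \dfrac{n^{d-1}}{48d}$. -/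

import Mathlib

open Relation

universe u w

/-- The vertex `t` is the end of the path of `D` that starts at `s`: it is reached from `s` along
directed edges of `D`, and no edge of `D` leaves it. -/
def Digraph.IsEndFrom {V : Type u} (D : Digraph V) (s t : V) : Prop :=
  ReflTransGen D.Adj s t ∧ ∀ x, ¬ D.Adj t x

namespace PathSearch

/-- The two promises on the hidden directed graph. -/
inductive Setting
  | one
  | two

/-- The two kinds of queries. -/
inductive QueryType
  | A
  | B

/-- `D` is an orientation of a set of edges of `G` (so it has no loops and no pair of opposite
edges), every outdegree is at most one, and the indegree of `s` is zero. -/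
structure IsHidden {V : Type u} (G : SimpleGraph V) (s : V) (D : Digraph V) : Prop where
  le : ∀ x y, D.Adj x y → G.Adj x y
  asymm : ∀ x y, D.Adj x y → ¬ D.Adj y x
  out_le_one : ∀ x y z, D.Adj x y → D.Adj x z → y = z
  no_in_source : ∀ x, ¬ D.Adj x s

/-- The hidden digraphs that are allowed in each setting.
* Setting one: every vertex other than `s` has indegree exactly one.
* Setting two: the edges of `D` are exactly the consecutive, directed edges of one path of `G`
  starting at `s` (possibly of length zero). -/
def Setting.Valid {V : Type u} (G : SimpleGraph V) (s : V) : Setting → Digraph V → Prop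
  | .one, D => IsHidden G s D ∧ ∀ v, v ≠ s → ∃! x, D.Adj x v
  | .two, D => IsHidden G s D ∧ ∃ (t : V) (p : G.Walk s t), p.IsPath ∧
      ∀ x y, D.Adj x y ↔ ∃ e ∈ p.darts, e.fst = x ∧ e.snd = y

/-- The possible answers to a query of type A at a vertex `v`: `v` is the end of the path; or the
edge of `D` that leaves `v` (given by its head); or `v` is not on the path. -/
inductive AnswerA (V : Type u) : Type u
  | isEnd
  | edgeTo (x : V)
  | notOnPath

/-- The type of answers. For a query of type B it is a set of directed edges. -/
def Answer (V : Type u) : QueryType → Type u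
  | .A => AnswerA V
  | .B => Set (V × V)

open Classical in
/-- The answer to a query of type A at `v` (the outgoing edge is unique in a hidden digraph). -/
noncomputable def answerA {V : Type u} (D : Digraph V) (s v : V) : AnswerA V :=
  if D.IsEndFrom s v then .isEnd
  else if h : ∃ x, D.Adj v x then .edgeTo h.choose
  else .notOnPath

/-- The answer to a query of type B at `v`: the edges of `D` incident to `v`, with directions. -/
def answerB {V : Type u} (D : Digraph V) (v : V) : Set (V × V) :=
  {e | D.Adj e.1 e.2 ∧ (e.1 = v ∨ e.2 = v)}

/-- The answer to a query of the given type at `v`. -/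
noncomputable def answer {V : Type u} (D : Digraph V) (s : V) :
    (Q : QueryType) → V → Answer V Q
  | .A, v => answerA D s v
  | .B, v => answerB D v

/-- Adaptive deterministic algorithms: either stop and output a vertex, or query a vertex and
continue depending on the answer. -/
inductive Strategy (V : Type u) (α : Type w) : Type (max u w)
  | output (t : V) : Strategy V α
  | query (v : V) (next : α → Strategy V α) : Strategy V α

/-- The output of an algorithm when the query at `v` is answered by `f v`. -/
def Strategy.result {V : Type u} {α : Type w} (f : V → α) : Strategy V α → V
  | .output t => t
  | .query v next => (next (f v)).result f

/-- The number of queries asked by an algorithm when the query at `v` is answered by `f v`. -/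
def Strategy.cost {V : Type u} {α : Type w} (f : V → α) : Strategy V α → ℕ
  | .output _ => 0
  | .query v next => (next (f v)).cost f + 1

/-- Some algorithm finds the end of the path for every allowed hidden digraph, with at most `q`
queries in the worst case. -/
def Solvable {V : Type u} (S : Setting) (Q : QueryType) (G : SimpleGraph V) (s : V) (q : ℕ) :
    Prop :=
  ∃ T : Strategy V (Answer V Q), ∀ D : Digraph V, S.Valid G s D →
    D.IsEndFrom s (T.result (answer D s Q)) ∧ T.cost (answer D s Q) ≤ q

/-- The minimal number of queries of type `Q` needed to find the end of the path in setting `S`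
on the graph `G` with source `s`. -/
noncomputable def h {V : Type u} (S : Setting) (Q : QueryType) (G : SimpleGraph V) (s : V) : ℕ :=
  sInf {q | Solvable S Q G s q}

/-- The `d`-dimensional grid graph on `{0, …, n-1}^d`: two vertices are adjacent if they differ in
exactly one coordinate, and by one in that coordinate. -/
def grid (d n : ℕ) : SimpleGraph (Fin d → Fin n) where
  Adj x y := ∃ i, ((x i : ℕ) + 1 = y i ∨ (y i : ℕ) + 1 = x i) ∧ ∀ j, j ≠ i → x j = y j
  symm := ⟨fun _ _ ⟨i, hi, hj⟩ => ⟨i, hi.symm, fun j hji => (hj j hji).symm⟩⟩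
  loopless := ⟨fun _ ⟨_, hi, _⟩ => by omega⟩

/-- The source `(0, …, 0)` of the grid. -/
def origin (d n : ℕ) [NeZero n] : Fin d → Fin n := fun _ => 0

/-! The minimum in the definition of `h` is over a nonempty set on every finite graph. -/

theorem Setting.Valid.exists_end {V : Type u} [Finite V] {S : Setting} {G : SimpleGraph V} {s : V}
    {D : Digraph V} (hD : S.Valid G s D) : ∃ t, D.IsEndFrom s t := by
  cases S with
  | one =>
    obtain ⟨hD, hin⟩ := hD
    by_contra hne
    have hout : ∀ t : {t // ReflTransGen D.Adj s t}, ∃ x, D.Adj t.1 x := by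
      intro t
      by_contra hc
      exact hne ⟨t.1, t.2, fun x hx => hc ⟨x, hx⟩⟩
    choose f hf using hout
    let g : {t // ReflTransGen D.Adj s t} → {t // ReflTransGen D.Adj s t} :=
      fun t => ⟨f t, t.2.tail (hf t)⟩
    have hg : Function.Injective g := by
      intro a b hab
      have hab' : f a = f b := congrArg Subtype.val hab
      have hs : f a ≠ s := by
        intro hs
        have h1 := hf a
        rw [hs] at h1
        exact hD.no_in_source a.1 h1
      exact Subtype.ext ((hin _ hs).unique (hf a) (hab' ▸ hf b))
    obtain ⟨a, ha⟩ := (Finite.injective_iff_surjective.1 hg) ⟨s, .refl⟩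
    have ha' : f a = s := congrArg Subtype.val ha
    have h1 := hf a
    rw [ha'] at h1
    exact hD.no_in_source a.1 h1
  | two =>
    obtain ⟨-, t, p, hp, hadj⟩ := hD
    have h1 : ∀ {a b : V} (q : G.Walk a b),
        ReflTransGen (fun x y => ∃ e ∈ q.darts, e.fst = x ∧ e.snd = y) a b := by
      intro a b q
      induction q with
      | nil => exact .refl
      | cons hab q ih =>
        refine .head ⟨⟨(_, _), hab⟩, by simp, rfl, rfl⟩ (ReflTransGen.mono ?_ _ _ ih)
        rintro x y ⟨e, he, hx⟩
        exact ⟨e, by simp [he], hx⟩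
    have h2 : ∀ {a b : V} (q : G.Walk a b), q.IsPath → ∀ e ∈ q.darts, e.fst ≠ b := by
      intro a b q
      induction q with
      | nil => simp
      | cons hab q ih =>
        intro hq e he
        rw [SimpleGraph.Walk.cons_isPath_iff] at hq
        rw [SimpleGraph.Walk.darts_cons, List.mem_cons] at he
        rcases he with rfl | he
        · intro heq
          exact hq.2 (by simpa using heq ▸ q.end_mem_support)
        · exact ih hq.1 e he
    refine ⟨t, ReflTransGen.mono (fun x y hxy => (hadj x y).2 hxy) _ _ (h1 p), fun x hx => ?_⟩
    obtain ⟨e, he, hx, -⟩ := (hadj t x).1 hx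
    exact h2 p hp e he hx

theorem isEndFrom_of_answer_eq {V : Type u} {Q : QueryType} {D D' : Digraph V} {s t : V}
    (hans : answer D s Q = answer D' s Q) (ht : D.IsEndFrom s t) : D'.IsEndFrom s t := by
  cases Q with
  | A =>
    have h1 : answerA D s t = answerA D' s t := congrFun hans t
    by_contra hc
    by_cases hx : ∃ x, D'.Adj t x <;> simp [answerA, ht, hc, hx] at h1
  | B =>
    have h1 : ∀ x y, D.Adj x y ↔ D'.Adj x y := by
      intro x y
      have h2 : answerB D x = answerB D' x := congrFun hans x
      have h3 := Set.ext_iff.1 h2 (x, y)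
      simpa [answerB] using h3
    have h4 : D.Adj = D'.Adj := by
      funext x y
      exact propext (h1 x y)
    unfold Digraph.IsEndFrom at *
    rwa [← h4]

theorem exists_solvable {V : Type u} [Finite V] (S : Setting) (Q : QueryType) (G : SimpleGraph V)
    (s : V) : ∃ q, Solvable S Q G s q := by
  classical
  have := Fintype.ofFinite V
  have key : ∀ (l : List V) (g : V → Answer V Q) (dec : (V → Answer V Q) → V),
      ∃ T : Strategy V (Answer V Q), ∀ f, (∀ v, v ∉ l → f v = g v) →
        T.result f = dec f ∧ T.cost f ≤ l.length := by
    intro l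
    induction l with
    | nil =>
      intro g dec
      refine ⟨.output (dec g), fun f hf => ?_⟩
      have hfg : f = g := funext fun v => hf v (by simp)
      simp [Strategy.result, Strategy.cost, hfg]
    | cons v l ih =>
      intro g dec
      choose T hT using fun a => ih (Function.update g v a) dec
      refine ⟨.query v T, fun f hf => ?_⟩
      have := hT (f v) f (by
        intro x hx
        by_cases hxv : x = v
        · subst hxv; simp
        · simpa [Function.update_of_ne hxv] using hf x (by simp [hxv, hx]))
      exact ⟨this.1, by simpa [Strategy.cost] using this.2⟩
  let dec : (V → Answer V Q) → V := fun f =>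
    if hf : ∃ t, ∃ D : Digraph V, answer D s Q = f ∧ D.IsEndFrom s t then hf.choose else s
  obtain ⟨T, hT⟩ := key Finset.univ.toList (answer ⟨fun _ _ => False⟩ s Q) dec
  refine ⟨(Finset.univ : Finset V).toList.length, T, fun D hD => ?_⟩
  obtain ⟨h1, h2⟩ := hT (answer D s Q) (by simp)
  refine ⟨?_, h2⟩
  obtain ⟨t, ht⟩ := hD.exists_end
  have hex : ∃ t, ∃ D' : Digraph V, answer D' s Q = answer D s Q ∧ D'.IsEndFrom s t :=
    ⟨t, D, rfl, ht⟩
  obtain ⟨D', h3, h4⟩ := hex.choose_spec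
  rw [h1]
  simp only [dec, dif_pos hex]
  exact isEndFrom_of_answer_eq h3 h4

/-- The number `h S Q G s` of queries suffices on a finite graph. -/
theorem solvable_h {V : Type u} [Finite V] (S : Setting) (Q : QueryType) (G : SimpleGraph V)
    (s : V) : Solvable S Q G s (h S Q G s) :=
  Nat.sInf_mem (exists_solvable S Q G s)

end PathSearch

/-! Upper bound. A path is a unit flow from `s` to `t`, and cycles carry no net flow. So the
directed edges across the boundary of a vertex set `R` tell whether `t` lies in `R`
(`end_mem_iff_of_crossing`). In a box of `k` vertices known to contain `t`, with known boundary
edges, a cut across the longest side at its median has two adjacent layers of together at most `2 k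
^ (1 - 1/d)` vertices. Querying these decides which part contains `t`, and the process repeats
there. The costs decrease geometrically, so the total is `O(k ^ (1 - 1/d))` (`solvableOn_box`),
which is `O(n ^ (d - 1))` for the whole grid.

Lower bounds. An adversary keeps the current end of the path inside a large connected part of the
graph that no query has touched. After each query the untouched part shrinks to `K Q`, where `Q` is
the set of touched vertices and `K` is a haven; the adversary prolongs the path through the old part
until it enters the new one. As long as at most `q` vertices are touched, the end stays ambiguous
(`IsSupply.not_solvable`). Havens come from routings: if all pairs of vertices are joined by walks
with few walks through each vertex, then deleting few vertices leaves a component with more than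
half of all vertices (`HasRouting.exists_haven`). In the grid, walks that correct one coordinate
after the other have small congestion.

In Setting 2 the path is simply prolonged edge by edge. In Setting 1 all vertices must stay covered,
so the grid is tiled by directed four-cycles, the 2 × 2 squares, and these squares play the role of
vertices. The path prolongs itself by absorbing an untouched square; reversing its last three edges
moves its end to another corner of the last square, which gives both mobility and ambiguity. For odd
`n` the leftover strip is covered by an initial piece of the path and by long cycles. Type B answers
determine type A answers, so lower bounds for B pass to A. -/

namespace PathSearch

/-! ### Flow conservation, and what an answer reveals -/

theorem Setting.Valid.isHidden {V : Type u} {S : Setting} {G : SimpleGraph V} {s : V}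
    {D : Digraph V} (hD : S.Valid G s D) : IsHidden G s D := by
  cases S with
  | one => exact hD.1
  | two => exact hD.1

theorem IsHidden.end_unique {V : Type u} {G : SimpleGraph V} {s t t' : V} {D : Digraph V}
    (hD : IsHidden G s D) (ht : D.IsEndFrom s t) (ht' : D.IsEndFrom s t') : t = t' := by
  have key : ∀ {a b : V}, ReflTransGen D.Adj a b → (∀ x, ¬ D.Adj a x) → a = b := by
    intro a b hab ha
    rcases ReflTransGen.cases_head hab with h | ⟨c, hc, -⟩
    · exact h
    · exact absurd hc (ha c)
  have hu : Relator.RightUnique D.Adj := fun x y z hy hz => hD.out_le_one x y z hy hz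
  rcases ReflTransGen.total_of_right_unique hu ht.1 ht'.1 with h | h
  · exact key h ht.2
  · exact (key h ht'.2).symm

open scoped Classical in
theorem sum_ite_eq_ite_exists {V : Type u} [Fintype V] (P : V → Prop)
    (hP : ∀ x y, P x → P y → x = y) :
    (∑ y, if P y then 1 else 0) = if ∃ y, P y then 1 else 0 := by
  by_cases h : ∃ y, P y
  · obtain ⟨y, hy⟩ := h
    rw [if_pos ⟨y, hy⟩, Finset.sum_eq_single y]
    · simp [hy]
    · intro z _ hz
      exact if_neg fun hPz => hz (hP z y hPz hy)
    · simp
  · rw [if_neg h]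
    push Not at h
    simp [h]

open scoped Classical in
/-- Flow conservation at a vertex: the source produces one unit and the end absorbs it. -/
theorem Setting.Valid.balance {V : Type u} [Fintype V] {S : Setting} {G : SimpleGraph V} {s t : V}
    {D : Digraph V} (hD : S.Valid G s D) (ht : D.IsEndFrom s t) (v : V) :
    (∑ y, if D.Adj v y then 1 else 0) + (if v = t then 1 else 0) =
      (∑ x, if D.Adj x v then 1 else 0) + (if v = s then 1 else 0) := by
  cases S with
  | one =>
    obtain ⟨hD, hin⟩ := hD
    have h1 : ∀ v, (∑ x, if D.Adj x v then 1 else 0) + (if v = s then 1 else 0) = 1 := by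
      intro v
      by_cases hv : v = s
      · subst hv
        simp [hD.no_in_source]
      · rw [sum_ite_eq_ite_exists (fun x => D.Adj x v)
          (fun x y hx hy => (hin v hv).unique hx hy)]
        simp [hv, (hin v hv).exists]
    have h2 : ∀ v, (∑ y, if D.Adj v y then 1 else 0) + (if v = t then 1 else 0) ≤ 1 := by
      intro v
      by_cases hv : v = t
      · subst hv
        simp [ht.2]
      · rw [sum_ite_eq_ite_exists (fun y => D.Adj v y) (fun x y hx hy => hD.out_le_one v x y hx hy)]
        split_ifs <;> simp
    -- Outdegrees and indegrees have the same sum, so both sides of the balance have the same total.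
    -- Since `h2` bounds each term by one, every term equals one.
    have h3 : ∑ v, ((∑ y, if D.Adj v y then 1 else 0) + (if v = t then 1 else 0)) =
        ∑ _v : V, 1 := by
      rw [← Finset.sum_congr rfl fun v _ => h1 v, Finset.sum_add_distrib, Finset.sum_add_distrib,
        Finset.sum_comm]
      simp
    rw [h1 v]
    exact (Finset.sum_eq_sum_iff_of_le fun v _ => h2 v).1 h3 v (Finset.mem_univ v)
  | two =>
    obtain ⟨hD, t', p, hp, hadj⟩ := hD
    have hout : ∀ v, (∃ y, D.Adj v y) ↔ v ∈ p.support.dropLast := by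
      intro v
      rw [← p.map_fst_darts]
      simp only [hadj, List.mem_map]
      exact ⟨fun ⟨y, e, he, h, _⟩ => ⟨e, he, h⟩, fun ⟨e, he, h⟩ => ⟨e.snd, e, he, h, rfl⟩⟩
    have hin : ∀ v, (∃ x, D.Adj x v) ↔ v ∈ p.support.tail := by
      intro v
      rw [← p.map_snd_darts]
      simp only [hadj, List.mem_map]
      exact ⟨fun ⟨y, e, he, _, h⟩ => ⟨e, he, h⟩, fun ⟨e, he, h⟩ => ⟨e.fst, e, he, rfl, h⟩⟩
    have hnd := hp.support_nodup
    have hs : p.support = s :: p.support.tail := p.cons_tail_support.symm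
    have ht' : p.support = p.support.dropLast ++ [t'] := by
      conv_lhs => rw [← List.dropLast_append_getLast p.support_ne_nil, p.getLast_support]
    have hsu : ∀ x y, D.Adj x v → D.Adj y v → x = y := by
      intro x y hx hy
      obtain ⟨e, he, rfl, h1⟩ := (hadj _ _).1 hx
      obtain ⟨e', he', rfl, h2⟩ := (hadj _ _).1 hy
      have hnt : (p.darts.map (·.snd)).Nodup := by
        rw [p.map_snd_darts]; exact hnd.tail
      rw [List.inj_on_of_nodup_map hnt he he' (h1.trans h2.symm)]
    have htt : t = t' := by
      have hreach : ∀ x, ReflTransGen D.Adj s x → x ∈ p.support := by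
        intro x hx
        induction hx with
        | refl => exact p.start_mem_support
        | tail _ h _ =>
          rw [hs]
          exact List.mem_cons_of_mem _ ((hin _).1 ⟨_, h⟩)
      have h1 := hreach t ht.1
      rw [ht', List.mem_append, ← hout] at h1
      rcases h1 with ⟨y, hy⟩ | h1
      · exact absurd hy (ht.2 y)
      · simpa using h1
    subst htt
    rw [sum_ite_eq_ite_exists (fun y => D.Adj v y) (fun x y hx hy => hD.out_le_one v x y hx hy),
      sum_ite_eq_ite_exists (fun x => D.Adj x v) hsu]
    simp only [hout, hin]
    have h1 : v ∈ p.support ↔ v ∈ p.support.dropLast ∨ v = t := by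
      conv_lhs => rw [ht']
      rw [List.mem_append, List.mem_singleton]
    have h2 : v ∈ p.support ↔ v = s ∨ v ∈ p.support.tail := by
      conv_lhs => rw [hs]
      rw [List.mem_cons]
    have h3 : v = t → v ∉ p.support.dropLast := by
      rintro rfl hmem
      rw [ht', List.nodup_append] at hnd
      exact hnd.2.2 v hmem v (by simp) rfl
    have h4 : v = s → v ∉ p.support.tail := by
      rintro rfl
      rw [hs, List.nodup_cons] at hnd
      exact hnd.1
    split_ifs <;> first | rfl | (exfalso; tauto)

open scoped Classical in
/-- The vertices of `R` send out, through the boundary of `R`, what they receive through it, except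
for the contributions of the source and of the end. -/
theorem Setting.Valid.flow {V : Type u} [Fintype V] {S : Setting} {G : SimpleGraph V} {s t : V}
    {D : Digraph V} (hD : S.Valid G s D) (ht : D.IsEndFrom s t) (R : Finset V) :
    (∑ v ∈ R, ∑ y ∈ Rᶜ, if D.Adj v y then 1 else 0) + (if t ∈ R then 1 else 0) =
      (∑ v ∈ R, ∑ x ∈ Rᶜ, if D.Adj x v then 1 else 0) + (if s ∈ R then 1 else 0) := by
  have h1 := Finset.sum_congr (rfl : R = R) fun v _ => hD.balance ht v
  rw [Finset.sum_add_distrib, Finset.sum_add_distrib, Finset.sum_ite_eq', Finset.sum_ite_eq'] at h1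
  have h2 : ∀ f : V → V → ℕ, ∑ v ∈ R, ∑ y, f v y =
      (∑ v ∈ R, ∑ y ∈ R, f v y) + ∑ v ∈ R, ∑ y ∈ Rᶜ, f v y := by
    intro f
    rw [← Finset.sum_add_distrib]
    exact Finset.sum_congr rfl fun v _ => (Finset.sum_add_sum_compl R _).symm
  rw [h2, h2, Finset.sum_comm (s := R) (t := R)] at h1
  omega

/-- In `flow`, everything except the term of the end is determined by the crossing edges and by the
position of `s`. This is the test that drives the search algorithm. -/
theorem end_mem_iff_of_crossing {V : Type u} [Finite V] {S : Setting} {G : SimpleGraph V}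
    {s t t' : V} {D D' : Digraph V} (hD : S.Valid G s D) (hD' : S.Valid G s D')
    (ht : D.IsEndFrom s t) (ht' : D'.IsEndFrom s t') (R : Finset V)
    (hcross : ∀ x y, ¬ (x ∈ R ↔ y ∈ R) → (D.Adj x y ↔ D'.Adj x y)) : t ∈ R ↔ t' ∈ R := by
  classical
  have := Fintype.ofFinite V
  have h1 := hD.flow ht R
  have h2 := hD'.flow ht' R
  have h3 : (∑ v ∈ R, ∑ y ∈ Rᶜ, if D.Adj v y then 1 else 0) =
      ∑ v ∈ R, ∑ y ∈ Rᶜ, if D'.Adj v y then 1 else 0 := by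
    refine Finset.sum_congr rfl fun v hv => Finset.sum_congr rfl fun y hy => ?_
    rw [Finset.mem_compl] at hy
    simp [hcross v y (by tauto)]
  have h4 : (∑ v ∈ R, ∑ x ∈ Rᶜ, if D.Adj x v then 1 else 0) =
      ∑ v ∈ R, ∑ x ∈ Rᶜ, if D'.Adj x v then 1 else 0 := by
    refine Finset.sum_congr rfl fun v hv => Finset.sum_congr rfl fun y hy => ?_
    rw [Finset.mem_compl] at hy
    simp [hcross y v (by tauto)]
  by_cases hR : t ∈ R <;> by_cases hR' : t' ∈ R <;> simp only [hR, hR', if_true, if_false] at h1 h2 ⊢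
    <;> omega

/-- A vertex is the end iff no edge leaves it and the path reaches it. -/
theorem Setting.Valid.isEndFrom_iff {V : Type u} [Finite V] {S : Setting} {G : SimpleGraph V}
    {s v : V} {D : Digraph V} (hD : S.Valid G s D) :
    D.IsEndFrom s v ↔ (∀ x, ¬ D.Adj v x) ∧ (v = s ∨ ∃ x, D.Adj x v) := by
  classical
  have := Fintype.ofFinite V
  constructor
  · intro hv
    refine ⟨hv.2, ?_⟩
    rcases ReflTransGen.cases_tail hv.1 with h | ⟨x, -, hx⟩
    · exact Or.inl h
    · exact Or.inr ⟨x, hx⟩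
  · rintro ⟨hout, hin⟩
    obtain ⟨t, ht⟩ := hD.exists_end
    have h1 := hD.balance ht v
    by_cases hvt : v = t
    · exact hvt ▸ ht
    · exfalso
      simp only [hout, hvt, if_false, Finset.sum_const_zero] at h1
      rcases hin with h | ⟨x, hx⟩
      · simp [h] at h1
      · have := Finset.sum_eq_zero_iff.1 (Nat.add_eq_zero_iff.1 h1.symm).1 x (Finset.mem_univ x)
        simp [hx] at this

/-- Both query types reveal the outgoing edge; the type A answers `isEnd` and `notOnPath` both mean
that there is none. The search uses nothing else, so one algorithm serves all settings and query
types. -/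
theorem adj_iff_of_answer_eq {V : Type u} {Q : QueryType} {S : Setting} {G : SimpleGraph V}
    {s v : V} {D D' : Digraph V} (hD : S.Valid G s D) (hD' : S.Valid G s D')
    (h : answer D s Q v = answer D' s Q v) (y : V) : D.Adj v y ↔ D'.Adj v y := by
  cases Q with
  | A =>
    have key : ∀ {D : Digraph V}, S.Valid G s D → (D.Adj v y ↔ answerA D s v = .edgeTo y) := by
      intro D hD
      unfold answerA
      split_ifs with h1 h2
      · simpa using h1.2 y
      · rw [AnswerA.edgeTo.injEq]
        exact ⟨fun h => hD.isHidden.out_le_one _ _ _ h2.choose_spec h,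
          fun h => h ▸ h2.choose_spec⟩
      · push Not at h2
        simpa using h2 y
    have h' : answerA D s v = answerA D' s v := h
    rw [key hD, key hD', h']
  | B =>
    have h' : answerB D v = answerB D' v := h
    have h1 := Set.ext_iff.1 h' (v, y)
    simpa [answerB] using h1

/-! ### Upper bound: search by halving boxes -/

/-- Some algorithm finds the end for every digraph of the class `P` with at most `r` queries. -/
def SolvableOn {V : Type u} (Q : QueryType) (s : V) (P : Set (Digraph V)) (r : ℝ) : Prop :=
  ∃ T : Strategy V (Answer V Q), ∀ D ∈ P,
    D.IsEndFrom s (T.result (answer D s Q)) ∧ (T.cost (answer D s Q) : ℝ) ≤ r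

theorem SolvableOn.mono {V : Type u} {Q : QueryType} {s : V} {P P' : Set (Digraph V)} {r r' : ℝ}
    (h : SolvableOn Q s P r) (hP : P' ⊆ P) (hr : r ≤ r') : SolvableOn Q s P' r' := by
  obtain ⟨T, hT⟩ := h
  exact ⟨T, fun D hD => ⟨(hT D (hP hD)).1, (hT D (hP hD)).2.trans hr⟩⟩

/-- Query all vertices of a list first, then continue depending on the answers. -/
theorem SolvableOn.of_queries {V : Type u} {Q : QueryType} {s : V} {r : ℝ} (l : List V)
    (P : Set (Digraph V))
    (h : ∀ D ∈ P, SolvableOn Q s {D' ∈ P | ∀ v ∈ l, answer D' s Q v = answer D s Q v} r) :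
    SolvableOn Q s P (l.length + r) := by
  classical
  induction l generalizing P with
  | nil =>
    by_cases hP : P.Nonempty
    · obtain ⟨D, hD⟩ := hP
      exact (h D hD).mono (fun D' hD' => ⟨hD', by simp⟩) (by simp)
    · rw [Set.not_nonempty_iff_eq_empty] at hP
      exact ⟨.output s, by simp [hP]⟩
  | cons v l ih =>
    have h1 : ∀ a : Answer V Q, SolvableOn Q s {D ∈ P | answer D s Q v = a} (l.length + r) := by
      intro a
      refine ih _ fun D hD => (h D hD.1).mono ?_ le_rfl
      rintro D' ⟨⟨hD', ha⟩, hl⟩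
      refine ⟨hD', fun x hx => ?_⟩
      rcases List.mem_cons.1 hx with rfl | hx
      · rw [ha, hD.2]
      · exact hl x hx
    choose T hT using h1
    refine ⟨.query v T, fun D hD => ?_⟩
    obtain ⟨h2, h3⟩ := hT (answer D s Q v) D ⟨hD, rfl⟩
    refine ⟨h2, ?_⟩
    simp only [Strategy.cost, List.length_cons, Nat.cast_add, Nat.cast_one]
    linarith

/-- A finite set of at least two elements of `Fin n` is split evenly by a threshold. -/
theorem exists_median {n : ℕ} (I : Finset (Fin n)) (hI : 2 ≤ I.card) :
    ∃ c : ℕ, (I.filter fun x : Fin n => (x : ℕ) < c).card = I.card / 2 := by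
  have hex : ∃ c : ℕ, I.card / 2 ≤ (I.filter fun x : Fin n => (x : ℕ) < c).card := by
    refine ⟨n, ?_⟩
    rw [Finset.filter_true_of_mem fun x _ => x.2]
    omega
  classical
  refine ⟨Nat.find hex, le_antisymm ?_ (Nat.find_spec hex)⟩
  obtain hc | ⟨c, hc⟩ : Nat.find hex = 0 ∨ ∃ c, Nat.find hex = c + 1 := by
    cases h : Nat.find hex with
    | zero => exact Or.inl rfl
    | succ c => exact Or.inr ⟨c, rfl⟩
  · rw [hc]
    simp
  · have h1 := Nat.find_min hex (m := c) (by omega)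
    rw [hc]
    have h2 : (I.filter fun x : Fin n => (x : ℕ) < c + 1) ⊆
        (I.filter fun x : Fin n => (x : ℕ) < c) ∪ (Finset.univ.filter fun x : Fin n => (x : ℕ) = c) := by
      intro x hx
      simp only [Finset.mem_filter, Finset.mem_union, Finset.mem_univ, true_and] at hx ⊢
      have := hx.2
      by_cases h : (x : ℕ) = c
      · exact Or.inr h
      · exact Or.inl ⟨hx.1, by omega⟩
    have h3 := (Finset.card_le_card h2).trans (Finset.card_union_le _ _)
    have h4 : (Finset.univ.filter fun x : Fin n => (x : ℕ) = c).card ≤ 1 := by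
      rw [Finset.card_le_one]
      intro a ha b hb
      simp only [Finset.mem_filter, Finset.mem_univ, true_and] at ha hb
      exact Fin.ext (ha.trans hb.symm)
    omega

theorem card_piFinset_update {d n : ℕ} (I : Fin d → Finset (Fin n)) (j : Fin d)
    (J : Finset (Fin n)) :
    (Fintype.piFinset (Function.update I j J)).card * (I j).card =
      J.card * (Fintype.piFinset I).card := by
  have h : ∀ K : Finset (Fin n), (Fintype.piFinset (Function.update I j K)).card =
      K.card * ∏ i ∈ Finset.univ.erase j, (I i).card := by
    intro K
    rw [Fintype.card_piFinset, ← Finset.mul_prod_erase _ _ (Finset.mem_univ j),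
      Function.update_self]
    congr 1
    refine Finset.prod_congr rfl fun i hi => ?_
    rw [Function.update_of_ne (Finset.ne_of_mem_erase hi)]
  have h1 := h (I j)
  rw [Function.update_eq_self] at h1
  rw [h J, h1]
  ring

theorem mem_piFinset_update {d n : ℕ} {I : Fin d → Finset (Fin n)} {j : Fin d}
    {J : Finset (Fin n)} (hJ : J ⊆ I j) {v : Fin d → Fin n} :
    v ∈ Fintype.piFinset (Function.update I j J) ↔ v ∈ Fintype.piFinset I ∧ v j ∈ J := by
  simp only [Fintype.mem_piFinset]
  constructor
  · intro h
    have hj : v j ∈ J := by simpa using h j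
    refine ⟨fun i => ?_, hj⟩
    by_cases hi : i = j
    · subst hi; exact hJ hj
    · simpa [hi] using h i
  · rintro ⟨h, hj⟩ i
    by_cases hi : i = j
    · subst hi; simpa using hj
    · simpa [hi] using h i

/-- One step of the recursion: `a` is the longest side, `l` the number of queries, `k'` the size of
the remaining box. With `p = 1 - 1/d`, the longest side is at least `k ^ (1/d)`, so `l ≤ 2 k ^ p`.
As `d ≥ 2` gives `p ≥ 1/2`, the factor `(2/3) ^ p` is at most `√(2/3) ≤ 5/6`. The constant 12 solves
`2 + (5/6) C = C`. -/
theorem halving_cost {d : ℕ} (hd : 2 ≤ d) {k k' a l : ℕ} (ha : 0 < a) (hka : k ≤ a ^ d)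
    (hk' : 3 * k' ≤ 2 * k) (hl : l * a ≤ 2 * k) :
    (l : ℝ) + 12 * (k' : ℝ) ^ (1 - 1 / (d : ℝ)) ≤ 12 * (k : ℝ) ^ (1 - 1 / (d : ℝ)) := by
  have hd0 : (0 : ℝ) < d := by positivity
  have hd2 : (2 : ℝ) ≤ d := by exact_mod_cast hd
  have hinv : 1 / (d : ℝ) ≤ 1 / 2 := one_div_le_one_div_of_le (by norm_num) hd2
  set p : ℝ := 1 - 1 / (d : ℝ) with hp
  have hp2 : 1 / 2 ≤ p := by linarith
  rcases Nat.eq_zero_or_pos k with rfl | hk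
  · have h1 : k' = 0 := by omega
    have h2 : l = 0 := by
      have : l * a = 0 := by omega
      simpa [ha.ne'] using this
    simp [h1, h2]
  have hk0 : (0 : ℝ) < k := by exact_mod_cast hk
  have ha0 : (0 : ℝ) < a := by exact_mod_cast ha
  have h1 : (k : ℝ) ^ (1 / (d : ℝ)) ≤ a := by
    have h2 : (k : ℝ) ≤ (a : ℝ) ^ (d : ℝ) := by
      rw [Real.rpow_natCast]; exact_mod_cast hka
    calc (k : ℝ) ^ (1 / (d : ℝ)) ≤ ((a : ℝ) ^ (d : ℝ)) ^ (1 / (d : ℝ)) :=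
          Real.rpow_le_rpow hk0.le h2 (by positivity)
      _ = a := by
          rw [← Real.rpow_mul ha0.le, mul_one_div_cancel hd0.ne', Real.rpow_one]
  have h3 : (k : ℝ) = (k : ℝ) ^ p * (k : ℝ) ^ (1 / (d : ℝ)) := by
    rw [← Real.rpow_add hk0, hp]
    simp
  have hkp : 0 < (k : ℝ) ^ p := Real.rpow_pos_of_pos hk0 p
  have h4 : (l : ℝ) ≤ 2 * (k : ℝ) ^ p := by
    have h5 : (l : ℝ) * a ≤ 2 * k := by exact_mod_cast hl
    have h6 : (l : ℝ) * a ≤ 2 * (k : ℝ) ^ p * a := by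
      calc (l : ℝ) * a ≤ 2 * ((k : ℝ) ^ p * (k : ℝ) ^ (1 / (d : ℝ))) := by rw [← h3]; exact h5
        _ ≤ 2 * (k : ℝ) ^ p * a := by nlinarith
    exact le_of_mul_le_mul_right h6 ha0
  have h7 : (k' : ℝ) ^ p ≤ 5 / 6 * (k : ℝ) ^ p := by
    have h8 : (k' : ℝ) ≤ 2 / 3 * k := by
      have : (3 : ℝ) * k' ≤ 2 * k := by exact_mod_cast hk'
      linarith
    calc (k' : ℝ) ^ p ≤ (2 / 3 * (k : ℝ)) ^ p :=
          Real.rpow_le_rpow (by positivity) h8 (by linarith)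
      _ = (2 / 3 : ℝ) ^ p * (k : ℝ) ^ p := Real.mul_rpow (by norm_num) hk0.le
      _ ≤ 5 / 6 * (k : ℝ) ^ p := by
          refine mul_le_mul_of_nonneg_right ?_ hkp.le
          calc (2 / 3 : ℝ) ^ p ≤ (2 / 3 : ℝ) ^ (1 / 2 : ℝ) :=
                Real.rpow_le_rpow_of_exponent_ge (by norm_num) (by norm_num) hp2
            _ = √(2 / 3) := (Real.sqrt_eq_rpow _).symm
            _ ≤ 5 / 6 := Real.sqrt_le_iff.2 ⟨by norm_num, by norm_num⟩
  linarith

/-- The digraphs whose end lies in `R` and which agree with `D₀` across the boundary of `R`. -/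
def boundaryClass {V : Type u} (S : Setting) (G : SimpleGraph V) (s : V) (D₀ : Digraph V)
    (R : Finset V) : Set (Digraph V) :=
  {D | S.Valid G s D ∧ (∀ x y, ¬ (x ∈ R ↔ y ∈ R) → (D.Adj x y ↔ D₀.Adj x y)) ∧
    ∃ t ∈ R, D.IsEndFrom s t}

/-- If `D` and `D₁` agree across the boundary of `R` and out of the vertices that separate `R'`
from the rest of `R`, then the end lies in `R'` for both of them or for none. -/
theorem mem_boundaryClass_of_separated {V : Type u} [Finite V] {S : Setting} {G : SimpleGraph V}
    {Q : QueryType} {s t₁ : V} {D D₀ D₁ : Digraph V} {R R' L : Finset V}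
    (hD : D ∈ boundaryClass S G s D₀ R) (hD₁ : D₁ ∈ boundaryClass S G s D₀ R)
    (hRR' : R' ⊆ R) (ht₁ : D₁.IsEndFrom s t₁) (ht₁' : t₁ ∈ R')
    (hL : ∀ x y, x ∈ R → y ∈ R → ¬ (x ∈ R' ↔ y ∈ R') → G.Adj x y → x ∈ L)
    (hans : ∀ v ∈ L, answer D s Q v = answer D₁ s Q v) : D ∈ boundaryClass S G s D₁ R' := by
  have hcross : ∀ x y, ¬ (x ∈ R' ↔ y ∈ R') → (D.Adj x y ↔ D₁.Adj x y) := by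
    intro x y hxy
    by_cases hR : x ∈ R ↔ y ∈ R
    · have hxR : x ∈ R := by
        by_contra hx
        have h1 : x ∉ R' := fun h => hx (hRR' h)
        have h2 : y ∉ R' := fun h => hx (hR.2 (hRR' h))
        exact hxy (by tauto)
      by_cases hG : G.Adj x y
      · exact adj_iff_of_answer_eq hD.1 hD₁.1 (hans x (hL x y hxR (hR.1 hxR) hxy hG)) y
      · exact ⟨fun h => absurd (hD.1.isHidden.le _ _ h) hG,
          fun h => absurd (hD₁.1.isHidden.le _ _ h) hG⟩
    · rw [hD.2.1 x y hR, hD₁.2.1 x y hR]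
  obtain ⟨t, -, ht⟩ := hD.2.2
  exact ⟨hD.1, hcross, t, (end_mem_iff_of_crossing hD.1 hD₁.1 ht ht₁ R' hcross).2 ht₁', ht⟩

/-- Strong induction on the size of the box, cutting the longest side. The sides `I i` may have
gaps: adjacent vertices on different sides of a threshold `c` still have the values `c - 1` and `c`
there. -/
theorem solvableOn_box {d n : ℕ} (hd : 2 ≤ d) (S : Setting) (Q : QueryType) (s : Fin d → Fin n)
    (k : ℕ) : ∀ (I : Fin d → Finset (Fin n)) (D₀ : Digraph (Fin d → Fin n)),
      (Fintype.piFinset I).card = k →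
      SolvableOn Q s (boundaryClass S (grid d n) s D₀ (Fintype.piFinset I))
        (12 * (k : ℝ) ^ (1 - 1 / (d : ℝ))) := by
  induction k using Nat.strong_induction_on with
  | _ k ih =>
    intro I D₀ hk
    have hnonneg : (0 : ℝ) ≤ 12 * (k : ℝ) ^ (1 - 1 / (d : ℝ)) := by positivity
    have : Nonempty (Fin d) := ⟨⟨0, by omega⟩⟩
    obtain ⟨j, hj⟩ := Finite.exists_max fun i => (I i).card
    have hka : k ≤ (I j).card ^ d := by
      rw [← hk, Fintype.card_piFinset]
      simpa using Finset.prod_le_pow_card Finset.univ (fun i => (I i).card) _ fun i _ => hj i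
    by_cases ha : (I j).card ≤ 1
    · -- the box has at most one vertex
      have hk1 : (Fintype.piFinset I).card ≤ 1 := by
        rw [hk]
        exact hka.trans (Nat.pow_le_one_iff (by omega) |>.2 ha)
      by_cases hne : (Fintype.piFinset I).Nonempty
      · obtain ⟨t, ht⟩ := hne
        refine ⟨.output t, fun D hD => ⟨?_, by simpa [Strategy.cost] using hnonneg⟩⟩
        obtain ⟨t', ht', hend⟩ := hD.2.2
        rwa [Finset.card_le_one.1 hk1 t' ht' t ht] at hend
      · refine ⟨.output s, fun D hD => ?_⟩
        obtain ⟨t', ht', -⟩ := hD.2.2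
        exact absurd ⟨t', ht'⟩ hne
    · push Not at ha
      obtain ⟨c, hc⟩ := exists_median (I j) ha
      set J₁ := (I j).filter fun x : Fin n => (x : ℕ) < c with hJ₁
      set J₂ := (I j).filter fun x : Fin n => ¬ (x : ℕ) < c with hJ₂
      -- Both layers at the cut are needed: an edge may cross it in either direction, and only the
      -- query at its tail is sure to reveal it.
      set J := (I j).filter fun x : Fin n => (x : ℕ) + 1 = c ∨ (x : ℕ) = c with hJ
      have hJ12 : J₁.card + J₂.card = (I j).card := Finset.card_filter_add_card_filter_not _
      have hJ2 : J.card ≤ 2 := by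
        have h1 : (J.map Fin.valEmbedding) ⊆ {c - 1, c} := by
          intro x hx
          simp only [hJ, Finset.mem_map, Finset.mem_filter, Fin.valEmbedding_apply] at hx
          obtain ⟨y, ⟨-, hy⟩, rfl⟩ := hx
          simp only [Finset.mem_insert, Finset.mem_singleton]
          omega
        simpa using (Finset.card_le_card h1).trans Finset.card_le_two
      have hsplit : ∀ J' : Finset (Fin n), J' ⊆ I j → 3 * J'.card ≤ 2 * (I j).card →
          3 * (Fintype.piFinset (Function.update I j J')).card ≤ 2 * k := by
        intro J' _ h
        have h1 := card_piFinset_update I j J'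
        rw [hk] at h1
        by_contra hcon
        push Not at hcon
        have h2 : 0 < (I j).card := by omega
        nlinarith [Nat.mul_le_mul_right k h]
      have hlayer := card_piFinset_update I j J
      rw [hk] at hlayer
      have hl : (Fintype.piFinset (Function.update I j J)).card * (I j).card ≤ 2 * k := by
        rw [hlayer]
        exact Nat.mul_le_mul_right k hJ2
      have hkpos : ∀ J' : Finset (Fin n), J' ⊆ I j → 3 * J'.card ≤ 2 * (I j).card →
          SolvableOn Q s (boundaryClass S (grid d n) s D₀ (Fintype.piFinset I)) 0 ∨
          ∀ D₁, SolvableOn Q s (boundaryClass S (grid d n) s D₁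
            (Fintype.piFinset (Function.update I j J')))
            (12 * (k : ℝ) ^ (1 - 1 / (d : ℝ)) -
              (Fintype.piFinset (Function.update I j J)).toList.length) := by
        intro J' hJ' h
        -- The induction hypothesis needs a strictly smaller box. This fails only for an empty box,
        -- and then the class of digraphs is empty.
        rcases Nat.eq_zero_or_pos k with hk0 | hk0
        · left
          refine ⟨.output s, fun D hD => ?_⟩
          obtain ⟨t', ht', -⟩ := hD.2.2
          rw [hk0, Finset.card_eq_zero] at hk
          simp [hk] at ht'
        · right
          intro D₁
          have h1 := hsplit J' hJ' h
          refine (ih _ (by omega) _ D₁ rfl).mono subset_rfl ?_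
          have h2 := halving_cost hd (by omega) hka h1 hl
          rw [Finset.length_toList]
          linarith
      rcases hkpos J₁ (Finset.filter_subset _ _) (by omega) with h0 | h1
      · exact h0.mono subset_rfl hnonneg
      rcases hkpos J₂ (Finset.filter_subset _ _) (by omega) with h0 | h2
      · exact h0.mono subset_rfl hnonneg
      refine (SolvableOn.of_queries (Fintype.piFinset (Function.update I j J)).toList _
        (r := 12 * (k : ℝ) ^ (1 - 1 / (d : ℝ)) -
          (Fintype.piFinset (Function.update I j J)).toList.length) ?_).mono subset_rfl
        (by linarith)
      intro D₁ hD₁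
      have hlayer' : ∀ x y, x ∈ Fintype.piFinset I → y ∈ Fintype.piFinset I →
          ¬ ((x j : ℕ) < c ↔ (y j : ℕ) < c) → (grid d n).Adj x y →
          x ∈ Fintype.piFinset (Function.update I j J) := by
        rintro x y hx - hxy ⟨i, hi, hne⟩
        have hij : j = i := by
          by_contra hji
          rw [hne j hji] at hxy
          exact hxy Iff.rfl
        subst hij
        rw [mem_piFinset_update (Finset.filter_subset _ _)]
        exact ⟨hx, Finset.mem_filter.2 ⟨Fintype.mem_piFinset.1 hx j, by omega⟩⟩
      have hmem₁ : ∀ x ∈ Fintype.piFinset I,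
          (x ∈ Fintype.piFinset (Function.update I j J₁) ↔ (x j : ℕ) < c) := by
        intro x hx
        rw [mem_piFinset_update (Finset.filter_subset _ _), Finset.mem_filter]
        exact ⟨fun h => h.2.2, fun h => ⟨hx, Fintype.mem_piFinset.1 hx j, h⟩⟩
      have hmem₂ : ∀ x ∈ Fintype.piFinset I,
          (x ∈ Fintype.piFinset (Function.update I j J₂) ↔ ¬ (x j : ℕ) < c) := by
        intro x hx
        rw [mem_piFinset_update (Finset.filter_subset _ _), Finset.mem_filter]
        exact ⟨fun h => h.2.2, fun h => ⟨hx, Fintype.mem_piFinset.1 hx j, h⟩⟩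
      obtain ⟨t₁, ht₁, hend⟩ := hD₁.2.2
      by_cases htc : (t₁ j : ℕ) < c
      · refine (h1 D₁).mono (fun D hD => ?_) le_rfl
        refine mem_boundaryClass_of_separated hD.1 hD₁ ?_ hend ((hmem₁ _ ht₁).2 htc) ?_
          (fun v hv => hD.2 v (Finset.mem_toList.2 hv))
        · exact fun x hx => ((mem_piFinset_update (Finset.filter_subset _ _)).1 hx).1
        · intro x y hx hy hxy
          rw [hmem₁ x hx, hmem₁ y hy] at hxy
          exact hlayer' x y hx hy hxy
      · refine (h2 D₁).mono (fun D hD => ?_) le_rfl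
        refine mem_boundaryClass_of_separated hD.1 hD₁ ?_ hend ((hmem₂ _ ht₁).2 htc) ?_
          (fun v hv => hD.2 v (Finset.mem_toList.2 hv))
        · exact fun x hx => ((mem_piFinset_update (Finset.filter_subset _ _)).1 hx).1
        · intro x y hx hy hxy
          rw [hmem₂ x hx, hmem₂ y hy] at hxy
          exact hlayer' x y hx hy (by tauto)

/-- In both settings and for both types of queries, `12 n ^ (d - 1)` queries suffice. -/
theorem h_grid_le {d n : ℕ} (hd : 2 ≤ d) (S : Setting) (Q : QueryType) (s : Fin d → Fin n) :
    (h S Q (grid d n) s : ℝ) ≤ 12 * (n : ℝ) ^ (d - 1) := by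
  -- The whole grid has no boundary, so the reference digraph does not matter.
  have h1 := solvableOn_box hd S Q s _ (fun _ => Finset.univ) ⟨fun _ _ => False⟩ rfl
  have hpow : (((Fintype.piFinset fun _ : Fin d => (Finset.univ : Finset (Fin n))).card : ℕ) : ℝ) ^
      (1 - 1 / (d : ℝ)) = (n : ℝ) ^ (d - 1) := by
    have hd0 : (d : ℝ) ≠ 0 := by positivity
    rw [Fintype.card_piFinset]
    simp only [Finset.card_univ, Fintype.card_fin, Finset.prod_const, Nat.cast_pow]
    rw [← Real.rpow_natCast, ← Real.rpow_mul (by positivity), ← Real.rpow_natCast]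
    congr 1
    rw [Nat.cast_sub (by omega)]
    field_simp
    simp
  rw [hpow] at h1
  obtain ⟨T, hT⟩ := h1
  have hsol : Solvable S Q (grid d n) s ⌊(12 : ℝ) * (n : ℝ) ^ (d - 1)⌋₊ := by
    refine ⟨T, fun D hD => ?_⟩
    obtain ⟨t, ht⟩ := hD.exists_end
    obtain ⟨h2, h3⟩ := hT D ⟨hD, by simp, t, by simp, ht⟩
    exact ⟨h2, Nat.le_floor h3⟩
  have h4 : h S Q (grid d n) s ≤ ⌊(12 : ℝ) * (n : ℝ) ^ (d - 1)⌋₊ := Nat.sInf_le hsol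
  exact (Nat.cast_le.2 h4).trans (Nat.floor_le (by positivity))

/-! ### Comparison of the two query types -/

theorem not_solvable_of_lt {V : Type u} [Finite V] {S : Setting} {Q : QueryType}
    {G : SimpleGraph V} {s : V} {b : ℝ} (hb : ∀ q : ℕ, (q : ℝ) < b → ¬ Solvable S Q G s q) :
    b ≤ h S Q G s := by
  by_contra hlt
  exact hb _ (not_le.1 hlt) (solvable_h S Q G s)

/-- In a valid digraph the answer of type B determines the answer of type A. -/
theorem answerA_eq_of_answerB_eq {V : Type u} [Finite V] {S : Setting} {G : SimpleGraph V}
    {s v : V} {D D' : Digraph V} (hD : S.Valid G s D) (hD' : S.Valid G s D')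
    (h : answerB D v = answerB D' v) : answerA D s v = answerA D' s v := by
  have hout : D.Adj v = D'.Adj v := by
    funext y
    have h1 := Set.ext_iff.1 h (v, y)
    simpa [answerB] using h1
  have hin : ∀ x, D.Adj x v ↔ D'.Adj x v := by
    intro x
    have h1 := Set.ext_iff.1 h (x, v)
    simpa [answerB] using h1
  have hend : D.IsEndFrom s v = D'.IsEndFrom s v :=
    propext (by rw [hD.isEndFrom_iff, hD'.isEndFrom_iff]; simp only [hin, hout])
  classical
  have hdite : ∀ f g : V → Prop, f = g →
      (if h : ∃ x, f x then AnswerA.edgeTo h.choose else .notOnPath : AnswerA V) =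
        if h : ∃ x, g x then .edgeTo h.choose else .notOnPath := by
    rintro f _ rfl
    rfl
  unfold answerA
  rw [hend]
  congr 1
  convert hdite _ _ hout

/-- Replace the answers seen by an algorithm. -/
def Strategy.mapAnswers {V : Type u} {α β : Type u} (f : V → β → α) : Strategy V α → Strategy V β
  | .output t => .output t
  | .query v next => .query v fun b => (next (f v b)).mapAnswers f

theorem Strategy.result_mapAnswers {V : Type u} {α β : Type u} {f : V → β → α} {g : V → β}
    {g' : V → α} (hg : ∀ v, f v (g v) = g' v) (T : Strategy V α) :
    (T.mapAnswers f).result g = T.result g' := by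
  induction T with
  | output t => rfl
  | query v next ih =>
    simp only [mapAnswers, result]
    rw [ih, hg]

theorem Strategy.cost_mapAnswers {V : Type u} {α β : Type u} {f : V → β → α} {g : V → β}
    {g' : V → α} (hg : ∀ v, f v (g v) = g' v) (T : Strategy V α) :
    (T.mapAnswers f).cost g = T.cost g' := by
  induction T with
  | output t => rfl
  | query v next ih =>
    simp only [mapAnswers, cost]
    rw [ih, hg]

theorem Solvable.of_A {V : Type u} [Finite V] {S : Setting} {G : SimpleGraph V} {s : V} {q : ℕ}
    (hq : Solvable S .A G s q) : Solvable S .B G s q := by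
  classical
  obtain ⟨T, hT⟩ := hq
  -- Any valid digraph with the given type B answer yields the right type A answer. The default
  -- value belongs to answers that never occur.
  let f : V → Set (V × V) → AnswerA V := fun v a =>
    if hD : ∃ D, S.Valid G s D ∧ answerB D v = a then answerA hD.choose s v else .notOnPath
  have hf : ∀ D, S.Valid G s D → ∀ v, f v (answerB D v) = answerA D s v := by
    intro D hD v
    have hex : ∃ D', S.Valid G s D' ∧ answerB D' v = answerB D v := ⟨D, hD, rfl⟩
    simp only [f, dif_pos hex]
    exact answerA_eq_of_answerB_eq hex.choose_spec.1 hD hex.choose_spec.2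
  refine ⟨Strategy.mapAnswers (α := AnswerA V) (β := Set (V × V)) f T, fun D hD => ?_⟩
  have h1 := Strategy.result_mapAnswers (g := answerB D) (g' := answerA D s) (hf D hD) T
  have h2 := Strategy.cost_mapAnswers (g := answerB D) (g' := answerA D s) (hf D hD) T
  have h3 := hT D hD
  refine ⟨?_, ?_⟩
  · exact h1.symm ▸ h3.1
  · exact h2.trans_le h3.2

/-! ### The adversary: havens and supplies -/

/-- A family of nonempty, connected vertex sets of `H`, one for every set `Q` of at most `q`
deleted vertices. It avoids `Q` and shrinks when `Q` grows. -/
structure IsHaven {W : Type w} (H : SimpleGraph W) (q : ℕ) (K : Set W → Set W) : Prop where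
  nonempty : ∀ Q : Set W, Q.encard ≤ q → (K Q).Nonempty
  disjoint : ∀ Q : Set W, Q.encard ≤ q → Disjoint Q (K Q)
  anti : ∀ Q Q' : Set W, Q ⊆ Q' → Q'.encard ≤ q → K Q' ⊆ K Q
  connected : ∀ Q : Set W, Q.encard ≤ q → ∀ x ∈ K Q, ∀ y ∈ K Q,
    ∃ p : H.Walk x y, p.IsPath ∧ ∀ z ∈ p.support, z ∈ K Q

/-- A supply of hidden digraphs for an adversary. Each vertex of `G` belongs to at most one block,
and the blocks are the vertices of a graph `H`. The digraphs `D` with `Inv C w D` have their end in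
the block `w`, and the blocks of `C` other than `w` are untouched by the path. -/
structure IsSupply {V : Type u} {W : Type w} (S : Setting) (G : SimpleGraph V) (s : V)
    (H : SimpleGraph W) (blk : V → Option W) (Inv : Set W → W → Digraph V → Prop) : Prop where
  valid : ∀ C w D, Inv C w D → S.Valid G s D
  mono : ∀ C C' w D, C' ⊆ C → Inv C w D → Inv C' w D
  move : ∀ C w w' D, Inv C w D → w ∈ C → w' ∈ C → H.Adj w w' →
    ∃ D', Inv (C \ {w}) w' D' ∧ ∀ v, (∀ c ∈ C, blk v ≠ some c) → answerB D' v = answerB D v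

/-- The adversary moves along `p` until it first meets `C'`. Blocks that it leaves are used up,
which does no harm: `p` does not return to them, and they lie outside `C'`. -/
theorem IsSupply.advance {V : Type u} {W : Type w} {S : Setting} {G : SimpleGraph V} {s : V}
    {H : SimpleGraph W} {blk : V → Option W} {Inv : Set W → W → Digraph V → Prop}
    (hI : IsSupply S G s H blk Inv) {x y : W} (p : H.Walk x y) :
    ∀ (C C' : Set W) (D : Digraph V), p.IsPath → (∀ z ∈ p.support, z ∈ C) → C' ⊆ C → y ∈ C' →
      Inv C x D → ∃ x' ∈ C', ∃ D', Inv C' x' D' ∧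
        ∀ v, (∀ c ∈ C, blk v ≠ some c) → answerB D' v = answerB D v := by
  induction p with
  | nil =>
    intro C C' D _ _ hC hy hD
    exact ⟨_, hy, D, hI.mono _ _ _ _ hC hD, fun _ _ => rfl⟩
  | @cons a b c hab p ih =>
    intro C C' D hp hpC hC hy hD
    by_cases ha : a ∈ C'
    · exact ⟨a, ha, D, hI.mono _ _ _ _ hC hD, fun _ _ => rfl⟩
    rw [SimpleGraph.Walk.cons_isPath_iff] at hp
    obtain ⟨D₁, hD₁, hag₁⟩ := hI.move C a b D hD (hpC a (by simp)) (hpC b (by simp)) hab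
    obtain ⟨x', hx', D', hD', hag'⟩ := ih (C \ {a}) C' D₁ hp.1
      (fun z hz => ⟨hpC z (by simp [hz]), fun h => hp.2 (h ▸ hz)⟩)
      (fun z hz => ⟨hC hz, fun h => ha (h ▸ hz)⟩) hy hD₁
    exact ⟨x', hx', D', hD', fun v hv => (hag' v fun c hc => hv c hc.1).trans (hag₁ v hv)⟩

/-- If some haven for `q` deleted blocks only contains ambiguous positions of a supply, then `q`
queries do not suffice. -/
theorem IsSupply.not_solvable {V : Type u} {W : Type w} {S : Setting} {G : SimpleGraph V} {s : V}
    {H : SimpleGraph W} {blk : V → Option W} {Inv : Set W → W → Digraph V → Prop}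
    (hI : IsSupply S G s H blk Inv) {q : ℕ} {K : Set W → Set W} (hK : IsHaven H q K)
    (hH : H.Preconnected)
    (amb : ∀ (Q : Set W) (w : W) (D : Digraph V) (t : V), Q.encard ≤ q → w ∈ K Q → Inv (K Q) w D →
      D.IsEndFrom s t → ∃ D', S.Valid G s D' ∧ ¬ D'.IsEndFrom s t ∧
        ∀ v, (∀ c ∈ K Q, blk v ≠ some c) → answerB D' v = answerB D v)
    {w₀ : W} {D₀ : Digraph V} (hD₀ : Inv Set.univ w₀ D₀) : ¬ Solvable S .B G s q := by
  -- `Q` is the set of blocks queried so far. The digraph `D'` is found for the remaining algorithm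
  -- `T` and keeps all answers outside the blocks of `K Q`, in particular those already given. A
  -- correct output then forces the total count above `q`.
  have key : ∀ (T : Strategy V (Set (V × V))) (Q : Set W) (w : W) (D : Digraph V),
      Q.encard ≤ q → w ∈ K Q → Inv (K Q) w D →
      ∃ D', S.Valid G s D' ∧ (∀ v, (∀ c ∈ K Q, blk v ≠ some c) → answerB D' v = answerB D v) ∧
        (D'.IsEndFrom s (T.result (answerB D')) → (q : ℕ∞) < Q.encard + T.cost (answerB D')) := by
    intro T
    induction T with
    | output t =>
      intro Q w D hQ hw hD
      by_cases ht : D.IsEndFrom s t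
      · obtain ⟨D', h1, h2, h3⟩ := amb Q w D t hQ hw hD ht
        exact ⟨D', h1, h3, fun h => absurd h h2⟩
      · exact ⟨D, hI.valid _ _ _ hD, fun _ _ => rfl, fun h => absurd h ht⟩
    | query v next ih =>
      intro Q w D hQ hw hD
      set Q' : Set W := Q ∪ {c | blk v = some c} with hQ'
      have hcard : Q'.encard ≤ Q.encard + 1 := by
        refine (Set.encard_union_le _ _).trans (add_le_add_right ?_ _)
        rw [Set.encard_le_one_iff]
        intro a b ha hb
        exact Option.some.inj (ha.symm.trans hb)
      by_cases hq : Q'.encard ≤ q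
      · have hanti := hK.anti Q Q' Set.subset_union_left hq
        obtain ⟨y, hy⟩ := hK.nonempty Q' hq
        obtain ⟨p, hp, hpK⟩ := hK.connected Q hQ w hw y (hanti hy)
        obtain ⟨w₁, hw₁, D₁, hD₁, hag₁⟩ := hI.advance p _ _ D hp hpK hanti hy hD
        obtain ⟨D', hval, hag', hend⟩ := ih (answerB D₁ v) Q' w₁ D₁ hq hw₁ hD₁
        -- The block of `v`, if there is one, lies in `Q'` and hence outside `K Q'`, so later moves
        -- keep the answer at `v`.
        have hv : answerB D' v = answerB D₁ v := by
          refine hag' v fun c hc hb => ?_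
          exact Set.disjoint_left.1 (hK.disjoint Q' hq) (Or.inr hb) hc
        refine ⟨D', hval, fun u hu => (hag' u fun c hc => hu c (hanti hc)).trans (hag₁ u hu), ?_⟩
        simp only [Strategy.result, Strategy.cost, hv]
        intro h
        refine (hend h).trans_le ((add_le_add_left hcard _).trans ?_)
        push_cast
        rw [add_assoc, add_comm 1]
      -- More than `q` blocks are touched, so the count exceeds `q` whatever follows.
      · refine ⟨D, hI.valid _ _ _ hD, fun _ _ => rfl, fun _ => (not_le.1 hq).trans_le ?_⟩
        refine hcard.trans (add_le_add_right ?_ _)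
        simp [Strategy.cost]
  rintro ⟨T, hT⟩
  have h0 : (∅ : Set W).encard ≤ q := by simp
  obtain ⟨y, hy⟩ := hK.nonempty ∅ h0
  classical
  obtain ⟨p, hp⟩ := (hH w₀ y).exists_isPath
  obtain ⟨w₁, hw₁, D₁, hD₁, -⟩ := hI.advance p Set.univ (K ∅) D₀ hp (fun _ _ => trivial)
    (Set.subset_univ _) hy hD₀
  obtain ⟨D', hval, -, hend⟩ := key T ∅ w₁ D₁ h0 hw₁ hD₁
  obtain ⟨h1, h2⟩ := hT D' hval
  have h3 := hend h1
  rw [Set.encard_empty, zero_add, Nat.cast_lt] at h3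
  exact absurd h2 (not_le.2 h3)

/-! ### Setting 2: prolonging a path edge by edge -/

/-- The digraphs whose edges are those of a path from `s` to `w` that avoids `C` before `w`. -/
def PathInv {V : Type u} (G : SimpleGraph V) (s : V) (C : Set V) (w : V) (D : Digraph V) : Prop :=
  IsHidden G s D ∧ D.IsEndFrom s w ∧ ∃ p : G.Walk s w, p.IsPath ∧
    (∀ x y, D.Adj x y ↔ ∃ e ∈ p.darts, e.fst = x ∧ e.snd = y) ∧ ∀ c ∈ C, c ∈ p.support → c = w

theorem pathInv_nil {V : Type u} (G : SimpleGraph V) (s : V) :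
    PathInv G s Set.univ s ⟨fun _ _ => False⟩ :=
  ⟨⟨fun _ _ h => h.elim, fun _ _ h => h.elim, fun _ _ _ h => h.elim, fun _ h => h.elim⟩,
    ⟨.refl, fun _ h => h⟩, .nil, by simp, by simp, by simp⟩

theorem PathInv.move {V : Type u} {G : SimpleGraph V} {s w w' : V} {C : Set V} {D : Digraph V}
    (hD : PathInv G s C w D) (hw : w ∈ C) (hw' : w' ∈ C) (hadj : G.Adj w w') :
    ∃ D', PathInv G s (C \ {w}) w' D' ∧ ∀ v, v ∉ C → answerB D' v = answerB D v := by
  obtain ⟨hhid, hend, p, hp, hpD, hpC⟩ := hD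
  have hne : w' ≠ w := hadj.ne'
  have hnot : w' ∉ p.support := fun h => hne (hpC w' hw' h)
  have hsupp : ∀ x y, D.Adj x y → x ∈ p.support ∧ y ∈ p.support := by
    intro x y hxy
    obtain ⟨e, he, rfl, rfl⟩ := (hpD x y).1 hxy
    exact ⟨p.dart_fst_mem_support_of_mem_darts he, p.dart_snd_mem_support_of_mem_darts he⟩
  refine ⟨⟨fun x y => D.Adj x y ∨ (x = w ∧ y = w')⟩, ⟨⟨?_, ?_, ?_, ?_⟩, ⟨?_, ?_⟩, p.concat hadj,
    ?_, ?_, ?_⟩, ?_⟩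
  · rintro x y (h | ⟨rfl, rfl⟩)
    · exact hhid.le x y h
    · exact hadj
  · rintro x y (h | ⟨rfl, rfl⟩) (h' | ⟨h1, h2⟩)
    · exact hhid.asymm x y h h'
    · exact hnot (h2 ▸ (hsupp x y h).1)
    · exact hnot (hsupp _ _ h').1
    · exact hne h1
  · rintro x y z (h | ⟨rfl, rfl⟩) (h' | ⟨h1, rfl⟩)
    · exact hhid.out_le_one x y z h h'
    · exact absurd (h1 ▸ h) (hend.2 y)
    · exact absurd h' (hend.2 z)
    · rfl
  · rintro x (h | ⟨rfl, rfl⟩)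
    · exact hhid.no_in_source x h
    · exact hnot p.start_mem_support
  · exact (ReflTransGen.mono (fun x y h => Or.inl h) _ _ hend.1).tail (Or.inr ⟨rfl, rfl⟩)
  · rintro x (h | ⟨h, -⟩)
    · exact hnot (hsupp _ _ h).1
    · exact hne h
  · exact hp.concat hnot hadj
  · intro x y
    simp only [SimpleGraph.Walk.darts_concat, List.concat_eq_append, List.mem_append,
      List.mem_singleton, or_and_right, exists_or, hpD x y, exists_eq_left]
    constructor
    · rintro (h | ⟨rfl, rfl⟩)
      · exact Or.inl h
      · exact Or.inr ⟨rfl, rfl⟩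
    · rintro (h | ⟨h1, h2⟩)
      · exact Or.inl h
      · exact Or.inr ⟨h1.symm, h2.symm⟩
  · rintro c ⟨hc, hcw⟩ hmem
    rw [SimpleGraph.Walk.support_concat, List.mem_append,
      List.mem_singleton] at hmem
    rcases hmem with hmem | hmem
    · exact absurd (hpC c hc hmem) hcw
    · exact hmem
  · intro v hv
    ext ⟨x, y⟩
    simp only [answerB, Set.mem_ofPred_eq]
    refine and_congr_left fun hxy => or_iff_left ?_
    rintro ⟨rfl, rfl⟩
    rcases hxy with rfl | rfl
    · exact hv hw
    · exact hv hw'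

theorem isSupply_pathInv {V : Type u} (G : SimpleGraph V) (s : V) :
    IsSupply .two G s G some (PathInv G s) where
  valid := fun _ w _ ⟨hhid, _, p, hp, hpD, _⟩ => ⟨hhid, w, p, hp, hpD⟩
  mono := fun _ _ _ _ hC ⟨hhid, hend, p, hp, hpD, hpC⟩ =>
    ⟨hhid, hend, p, hp, hpD, fun c hc => hpC c (hC hc)⟩
  move := by
    intro C w w' D hD hw hw' hadj
    obtain ⟨D', hD', hag⟩ := hD.move hw hw' hadj
    exact ⟨D', hD', fun v hv => hag v fun h => hv v h rfl⟩

/-- Here every vertex is its own block. A second vertex in the connected set `K Q` gives the current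
end a neighbour in it, and prolonging the path by that edge makes the end ambiguous. -/
theorem not_solvable_two_of_haven {V : Type u} {G : SimpleGraph V} (s : V) {q : ℕ}
    {K : Set V → Set V} (hG : G.Preconnected) (hK : IsHaven G q K)
    (hK2 : ∀ Q : Set V, Q.encard ≤ q → (K Q).Nontrivial) : ¬ Solvable .two .B G s q := by
  refine (isSupply_pathInv G s).not_solvable hK hG ?_ (pathInv_nil G s)
  intro Q w D t hQ hw hD ht
  obtain ⟨y, hy, hyw⟩ := (hK2 Q hQ).exists_ne w
  obtain ⟨p, -, hpK⟩ := hK.connected Q hQ w hw y hy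
  have hp : ∃ w' ∈ K Q, G.Adj w w' := by
    cases p with
    | nil => exact absurd rfl hyw
    | cons hadj p => exact ⟨_, hpK _ (by simp), hadj⟩
  obtain ⟨w', hw', hadj⟩ := hp
  obtain ⟨D', hD', hag⟩ := hD.move hw hw' hadj
  refine ⟨D', (isSupply_pathInv G s).valid _ _ _ hD', fun h => ?_, fun v hv =>
    hag v fun h => hv v h rfl⟩
  have h1 : w = t := hD.1.end_unique hD.2.1 ht
  have h2 : w' = t := hD'.1.end_unique hD'.2.1 h
  exact hadj.ne (h1.trans h2.symm)

/-! ### Routings of small congestion, and the havens they give -/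

/-- A choice of a walk of `H` between any two vertices, inside a set `R x y`, such that every vertex
lies in at most `c / 2` of the sets `R x y`. -/
def HasRouting {W : Type w} (H : SimpleGraph W) (c : ℕ) : Prop :=
  ∃ R : W → W → Set W, (∀ x y, ∃ p : H.Walk x y, ∀ z ∈ p.support, z ∈ R x y) ∧
    ∀ v, 2 * {p : W × W | v ∈ R p.1 p.2}.ncard ≤ c

theorem HasRouting.preconnected {W : Type w} {H : SimpleGraph W} {c : ℕ} (h : HasRouting H c) :
    H.Preconnected := by
  obtain ⟨R, hR, -⟩ := h
  exact fun x y => ⟨(hR x y).choose⟩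

/-- Walks correct the first coordinate, then the second. A walk through `(a, b)` in its first phase
starts at height `b` and has a free final height; in its second phase it ends over `a` and has a
free initial first coordinate. This yields the two summands. -/
theorem HasRouting.prod {X Y W : Type*} [Finite X] [Finite Y] {HX : SimpleGraph X}
    {HY : SimpleGraph Y} {H : SimpleGraph W} {cX cY : ℕ} (e : X × Y ≃ W) (hX : HasRouting HX cX)
    (hY : HasRouting HY cY) (h1 : ∀ x x' y, HX.Adj x x' → H.Adj (e (x, y)) (e (x', y)))
    (h2 : ∀ x y y', HY.Adj y y' → H.Adj (e (x, y)) (e (x, y'))) :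
    HasRouting H (cX * Nat.card Y + cY * Nat.card X) := by
  obtain ⟨RX, hRX, hcX⟩ := hX
  obtain ⟨RY, hRY, hcY⟩ := hY
  refine ⟨fun w w' => {u | ((e.symm u).1 ∈ RX (e.symm w).1 (e.symm w').1 ∧
    (e.symm u).2 = (e.symm w).2) ∨ ((e.symm u).1 = (e.symm w').1 ∧
    (e.symm u).2 ∈ RY (e.symm w).2 (e.symm w').2)}, ?_, ?_⟩
  · intro w w'
    obtain ⟨⟨x, y⟩, rfl⟩ := e.surjective w
    obtain ⟨⟨x', y'⟩, rfl⟩ := e.surjective w'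
    obtain ⟨p, hp⟩ := hRX x x'
    obtain ⟨p', hp'⟩ := hRY y y'
    let fX : HX →g H := ⟨fun x => e (x, y), fun h => h1 _ _ y h⟩
    let fY : HY →g H := ⟨fun y => e (x', y), fun h => h2 x' _ _ h⟩
    refine ⟨(p.map fX).append (p'.map fY), fun z hz => ?_⟩
    rw [SimpleGraph.Walk.mem_support_append_iff, SimpleGraph.Walk.support_map,
      SimpleGraph.Walk.support_map, List.mem_map, List.mem_map] at hz
    rcases hz with ⟨a, ha, rfl⟩ | ⟨a, ha, rfl⟩
    · left
      simpa [fX] using hp a ha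
    · right
      simpa [fY] using hp' a ha
  · intro v
    obtain ⟨⟨a, b⟩, rfl⟩ := e.surjective v
    set SX := {p : X × X | a ∈ RX p.1 p.2} with hSX
    set SY := {p : Y × Y | b ∈ RY p.1 p.2} with hSY
    let gX : (X × X) × Y → W × W := fun p => (e (p.1.1, b), e (p.1.2, p.2))
    let gY : (Y × Y) × X → W × W := fun p => (e (p.2, p.1.1), e (a, p.1.2))
    have hsub : {p : W × W | e (a, b) ∈ {u | ((e.symm u).1 ∈ RX (e.symm p.1).1 (e.symm p.2).1 ∧
        (e.symm u).2 = (e.symm p.1).2) ∨ ((e.symm u).1 = (e.symm p.2).1 ∧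
        (e.symm u).2 ∈ RY (e.symm p.1).2 (e.symm p.2).2)}} ⊆
        gX '' (SX ×ˢ Set.univ) ∪ gY '' (SY ×ˢ Set.univ) := by
      rintro ⟨w, w'⟩ hw
      obtain ⟨⟨x, y⟩, rfl⟩ := e.surjective w
      obtain ⟨⟨x', y'⟩, rfl⟩ := e.surjective w'
      simp only [Set.mem_ofPred_eq, Equiv.symm_apply_apply] at hw
      rcases hw with ⟨hw, rfl⟩ | ⟨rfl, hw⟩
      · exact Or.inl ⟨((x, x'), y'), ⟨hw, trivial⟩, rfl⟩
      · exact Or.inr ⟨((y, y'), x), ⟨hw, trivial⟩, rfl⟩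
    have : Finite W := Finite.of_equiv _ e
    have h3 := (Set.ncard_le_ncard hsub (Set.toFinite _)).trans (Set.ncard_union_le _ _)
    have h4 : (gX '' (SX ×ˢ Set.univ)).ncard ≤ SX.ncard * Nat.card Y :=
      (Set.ncard_image_le (Set.toFinite _)).trans (by rw [Set.ncard_prod, Set.ncard_univ])
    have h5 : (gY '' (SY ×ˢ Set.univ)).ncard ≤ SY.ncard * Nat.card X :=
      (Set.ncard_image_le (Set.toFinite _)).trans (by rw [Set.ncard_prod, Set.ncard_univ])
    have h6 := Nat.mul_le_mul_right (Nat.card Y) (hcX a)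
    have h7 := Nat.mul_le_mul_right (Nat.card X) (hcY b)
    rw [← hSX] at h6
    rw [← hSY] at h7
    linarith

theorem hasRouting_of_unique {W : Type w} [Unique W] (H : SimpleGraph W) : HasRouting H 2 := by
  refine ⟨fun _ _ => Set.univ, fun x y => ⟨SimpleGraph.Walk.nil.copy rfl (Subsingleton.elim x y),
    fun _ _ => trivial⟩, fun v => ?_⟩
  simp [Set.ncard_univ]

theorem exists_walk_pathGraph (n : ℕ) (x y : Fin n) :
    ∃ p : (SimpleGraph.pathGraph n).Walk x y, ∀ z ∈ p.support, z ∈ Set.uIcc x y := by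
  have key : ∀ (k : ℕ) (x y : Fin n), (x : ℕ) + k = y →
      ∃ p : (SimpleGraph.pathGraph n).Walk x y, ∀ z ∈ p.support, x ≤ z ∧ z ≤ y := by
    intro k
    induction k with
    | zero =>
      intro x y hxy
      obtain rfl : x = y := Fin.ext hxy
      exact ⟨.nil, by simp⟩
    | succ k ih =>
      intro x y hxy
      obtain ⟨p, hp⟩ := ih ⟨x + 1, by omega⟩ y (by simp; omega)
      refine ⟨.cons (SimpleGraph.pathGraph_adj.2 (Or.inl rfl)) p, fun z hz => ?_⟩
      rw [SimpleGraph.Walk.support_cons, List.mem_cons] at hz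
      rcases hz with rfl | hz
      · exact ⟨le_rfl, Fin.le_def.2 (by omega)⟩
      · have := hp z hz
        simp only [Fin.le_def] at this ⊢
        omega
  rcases le_total x y with h | h
  · obtain ⟨p, hp⟩ := key (y - x) x y (by rw [Fin.le_def] at h; omega)
    exact ⟨p, fun z hz => by rw [Set.uIcc_of_le h]; exact hp z hz⟩
  · obtain ⟨p, hp⟩ := key (x - y) y x (by rw [Fin.le_def] at h; omega)
    exact ⟨p.reverse, fun z hz => by
      rw [Set.uIcc_of_ge h]; exact hp z (by simpa using hz)⟩

/-- The vertex `v` lies between `x` and `y` for `2 (v + 1) (n - v) - 1` ordered pairs, since `(v,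
v)` occurs in both orders. The inequality `4 a b ≤ (a + b) ^ 2` bounds twice this number. -/
theorem hasRouting_pathGraph (n : ℕ) : HasRouting (SimpleGraph.pathGraph n) ((n + 1) ^ 2 - 2) := by
  refine ⟨Set.uIcc, exists_walk_pathGraph n, fun v => ?_⟩
  have hset : {p : Fin n × Fin n | v ∈ Set.uIcc p.1 p.2} =
      ((Finset.Iic v ×ˢ Finset.Ici v ∪ Finset.Ici v ×ˢ Finset.Iic v :
        Finset (Fin n × Fin n)) : Set (Fin n × Fin n)) := by
    ext ⟨x, y⟩
    simp only [Set.mem_ofPred_eq, Set.mem_uIcc, Finset.coe_union, Finset.coe_product,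
      Set.mem_union, Set.mem_prod, Finset.coe_Iic, Finset.coe_Ici, Set.mem_Iic, Set.mem_Ici]
    tauto
  have h1 := Finset.card_union_add_card_inter (Finset.Iic v ×ˢ Finset.Ici v)
    (Finset.Ici v ×ˢ Finset.Iic v)
  have h2 : 1 ≤ (Finset.Iic v ×ˢ Finset.Ici v ∩ Finset.Ici v ×ˢ Finset.Iic v).card :=
    Finset.card_pos.2 ⟨(v, v), by simp⟩
  rw [hset, Set.ncard_coe_finset]
  rw [Finset.card_product, Finset.card_product, Fin.card_Iic, Fin.card_Ici] at h1
  have hv := v.2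
  obtain ⟨m, hm⟩ : ∃ m, n = v + m := ⟨n - v, by omega⟩
  have h3 : n - (v : ℕ) = m := by omega
  rw [h3] at h1
  have h4 : 4 * (((v : ℕ) + 1) * m) ≤ (n + 1) ^ 2 := by
    have h5 : n + 1 = ((v : ℕ) + 1) + m := by omega
    rw [h5]
    nlinarith [sq_nonneg ((((v : ℕ) + 1 : ℕ) : ℤ) - (m : ℤ)), four_mul_le_sq_add ((v : ℕ) + 1) m]
  have h6 := mul_comm m ((v : ℕ) + 1)
  omega

theorem hasRouting_grid (d n : ℕ) :
    HasRouting (grid d n) (d * ((n + 1) ^ 2 - 2) * n ^ (d - 1) + 2 * n ^ d) := by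
  induction d with
  | zero => simpa using hasRouting_of_unique (grid 0 n)
  | succ d ih =>
    have h := (hasRouting_pathGraph n).prod (H := grid (d + 1) n)
      (Fin.consEquiv fun _ : Fin (d + 1) => Fin n) ih ?_ ?_
    · convert h using 1
      rcases d with _ | d
      · simp
      · simp [pow_succ]
        ring
    · intro x x' z h
      refine ⟨0, by simpa using SimpleGraph.pathGraph_adj.1 h, fun j hj => ?_⟩
      obtain ⟨j, rfl⟩ := Fin.exists_succ_eq.2 hj
      simp
    · rintro x z z' ⟨i, hi, hne⟩
      refine ⟨i.succ, by simpa using hi, fun j hj => ?_⟩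
      induction j using Fin.cases with
      | zero => simp
      | succ j => simpa using hne j fun h => hj (h ▸ rfl)

/-- Two vertices are joined by a walk that avoids `Q`. -/
def JoinedOff {W : Type w} (H : SimpleGraph W) (Q : Set W) (x y : W) : Prop :=
  ∃ p : H.Walk x y, ∀ z ∈ p.support, z ∉ Q

theorem JoinedOff.symm {W : Type w} {H : SimpleGraph W} {Q : Set W} {x y : W}
    (h : JoinedOff H Q x y) : JoinedOff H Q y x := by
  obtain ⟨p, hp⟩ := h
  exact ⟨p.reverse, fun z hz => hp z (by simpa using hz)⟩

theorem JoinedOff.trans {W : Type w} {H : SimpleGraph W} {Q : Set W} {x y z : W}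
    (h : JoinedOff H Q x y) (h' : JoinedOff H Q y z) : JoinedOff H Q x z := by
  obtain ⟨p, hp⟩ := h
  obtain ⟨p', hp'⟩ := h'
  refine ⟨p.append p', fun u hu => ?_⟩
  rcases (SimpleGraph.Walk.mem_support_append_iff _ _).1 hu with hu | hu
  · exact hp u hu
  · exact hp' u hu

theorem JoinedOff.anti {W : Type w} {H : SimpleGraph W} {Q Q' : Set W} {x y : W} (hQ : Q ⊆ Q')
    (h : JoinedOff H Q' x y) : JoinedOff H Q x y := by
  obtain ⟨p, hp⟩ := h
  exact ⟨p, fun z hz hzQ => hp z hz (hQ hzQ)⟩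

/-- If few vertices are deleted from a graph with a routing of small congestion, then more than
half of all vertices stay in one component. -/
theorem HasRouting.exists_large_component {W : Type w} [Finite W] {H : SimpleGraph W} {c q : ℕ}
    (hH : HasRouting H c) (hq : q * c < Nat.card W ^ 2) (Q : Set W) (hQ : Q.encard ≤ q) :
    ∃ x, Nat.card W < 2 * {y | JoinedOff H Q x y}.ncard := by
  classical
  have := Fintype.ofFinite W
  obtain ⟨R, hR, hc⟩ := hH
  by_contra hcon
  push Not at hcon
  set N := Nat.card W with hN
  -- A pair is joined off `Q` unless its route meets `Q`. If all components had at most half of the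
  -- vertices, at most half of the pairs would be joined, and the routes through `Q` are too few for
  -- the rest.
  have hcover : (Set.univ : Set (W × W)) ⊆
      (⋃ x ∈ (Finset.univ : Finset W), (fun y => (x, y)) '' {y | JoinedOff H Q x y}) ∪
      ⋃ v ∈ Q.toFinset, {p : W × W | v ∈ R p.1 p.2} := by
    rintro ⟨x, y⟩ -
    by_cases h : ∃ v ∈ Q, v ∈ R x y
    · right
      obtain ⟨v, hv, hvR⟩ := h
      exact Set.mem_biUnion (by simpa using hv) hvR
    · left
      obtain ⟨p, hp⟩ := hR x y
      exact Set.mem_biUnion (Finset.mem_coe.2 (Finset.mem_univ x))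
        ⟨y, ⟨p, fun z hz hzQ => h ⟨z, hzQ, hp z hz⟩⟩, rfl⟩
  have h1 := (Set.ncard_le_ncard hcover (Set.toFinite _)).trans (Set.ncard_union_le _ _)
  have h2 := Finset.set_ncard_biUnion_le (Finset.univ : Finset W)
    fun x => (fun y => (x, y)) '' {y | JoinedOff H Q x y}
  have h3 := Finset.set_ncard_biUnion_le Q.toFinset fun v => {p : W × W | v ∈ R p.1 p.2}
  have h4 : 2 * ∑ x : W, ((fun y => (x, y)) '' {y | JoinedOff H Q x y}).ncard ≤ N * N := by
    rw [Finset.mul_sum]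
    refine (Finset.sum_le_card_nsmul _ _ N fun x _ => ?_).trans (by simp [hN])
    exact (Nat.mul_le_mul_left 2 (Set.ncard_image_le (Set.toFinite _))).trans (hcon x)
  have h5 : 2 * ∑ v ∈ Q.toFinset, {p : W × W | v ∈ R p.1 p.2}.ncard ≤ q * c := by
    rw [Finset.mul_sum]
    refine (Finset.sum_le_card_nsmul _ _ c fun v _ => hc v).trans ?_
    rw [smul_eq_mul]
    refine Nat.mul_le_mul_right c ?_
    rw [← Set.coe_fintypeCard Q] at hQ
    rw [Set.toFinset_card]
    exact_mod_cast hQ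
  rw [Set.ncard_univ, Nat.card_prod, ← hN] at h1
  nlinarith

/-- `K Q` is the component with more than half of all vertices. Two such components, for `Q ⊆ Q'`,
must meet, and this gives the monotonicity. -/
theorem HasRouting.exists_haven {W : Type w} [Finite W] {H : SimpleGraph W} {c q : ℕ}
    (hH : HasRouting H c) (hq : q * c < Nat.card W ^ 2) :
    ∃ K : Set W → Set W, IsHaven H q K ∧
      ∀ Q : Set W, Q.encard ≤ q → Nat.card W < 2 * (K Q).ncard := by
  classical
  have : ∀ Q : Set W, ∃ x : W, Q.encard ≤ q →
      Nat.card W < 2 * {y | JoinedOff H Q x y}.ncard := by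
    intro Q
    by_cases hQ : Q.encard ≤ q
    · obtain ⟨x, hx⟩ := hH.exists_large_component hq Q hQ
      exact ⟨x, fun _ => hx⟩
    · have : Nonempty W := by
        by_contra hW
        rw [not_nonempty_iff] at hW
        simp at hq
      exact ⟨Classical.arbitrary W, fun h => absurd h hQ⟩
  choose x hx using this
  refine ⟨fun Q => {y | JoinedOff H Q (x Q) y}, ⟨?_, ?_, ?_, ?_⟩, hx⟩
  · intro Q hQ
    rw [← Set.ncard_pos]
    have := hx Q hQ
    omega
  · intro Q _
    rw [Set.disjoint_right]
    rintro y ⟨p, hp⟩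
    exact hp y p.end_mem_support
  · intro Q Q' hQQ' hQ' y hy
    have h1 := hx Q ((Set.encard_le_encard hQQ').trans hQ')
    have h2 := hx Q' hQ'
    have hmeet : ({y | JoinedOff H Q (x Q) y} ∩ {y | JoinedOff H Q' (x Q') y}).Nonempty := by
      by_contra hemp
      rw [Set.not_nonempty_iff_eq_empty, ← Set.disjoint_iff_inter_eq_empty] at hemp
      have h3 := Set.ncard_union_eq hemp
      have h4 := Set.ncard_le_ncard (Set.subset_univ
        ({y | JoinedOff H Q (x Q) y} ∪ {y | JoinedOff H Q' (x Q') y}))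
      rw [Set.ncard_univ] at h4
      omega
    obtain ⟨z, hz, hz'⟩ := hmeet
    exact JoinedOff.trans hz ((JoinedOff.symm hz').trans hy |>.anti hQQ')
  · intro Q _ a ha b hb
    obtain ⟨p, hp⟩ := JoinedOff.trans (JoinedOff.symm ha) hb
    refine ⟨p.toPath, p.toPath.2, fun z hz => ?_⟩
    have hz' := p.support_toPath_subset_support hz
    exact JoinedOff.trans ha ⟨p.takeUntil z hz', fun u hu =>
      hp u (p.support_takeUntil_subset_support hz' hu)⟩

theorem le_h_two_B {d n : ℕ} (hd : 1 ≤ d) (hn : 2 ≤ n) (s : Fin d → Fin n) :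
    (n : ℝ) ^ (d - 1) / (3 * (d : ℝ)) ≤ h .two .B (grid d n) s := by
  refine not_solvable_of_lt fun q hq => ?_
  obtain ⟨k, rfl⟩ : ∃ k, d = k + 1 := ⟨d - 1, by omega⟩
  have hcard : Nat.card (Fin (k + 1) → Fin n) = n ^ (k + 1) := by simp
  have hq' : 3 * (k + 1) * q < n ^ k := by
    rw [lt_div_iff₀ (by positivity)] at hq
    have : ((3 * (k + 1) * q : ℕ) : ℝ) < (n ^ k : ℕ) := by
      push_cast at hq ⊢
      linarith
    exact_mod_cast this
  have hR := hasRouting_grid (k + 1) n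
  obtain ⟨K, hK, hK2⟩ := hR.exists_haven (q := q) (by
    rw [hcard]
    simp only [Nat.add_sub_cancel]
    have h1 : (k + 1) * ((n + 1) ^ 2 - 2) * n ^ k + 2 * n ^ (k + 1) ≤
        3 * (k + 1) * n ^ k * n ^ 2 := by
      obtain ⟨m, hm⟩ : ∃ m, (n + 1) ^ 2 = m + 2 := ⟨(n + 1) ^ 2 - 2, by
        have : 2 ≤ (n + 1) ^ 2 := by nlinarith
        omega⟩
      rw [hm, Nat.add_sub_cancel]
      -- Here `m = n ^ 2 + 2 n - 1`; this is where `n ≥ 2` and the constant 3 come from.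
      have h2 : m + 2 * n ≤ 3 * n ^ 2 := by nlinarith
      have h3 : (k + 1) * m + 2 * n ≤ 3 * (k + 1) * n ^ 2 := by nlinarith [Nat.zero_le (k * n)]
      calc (k + 1) * m * n ^ k + 2 * n ^ (k + 1) = ((k + 1) * m + 2 * n) * n ^ k := by ring
        _ ≤ (3 * (k + 1) * n ^ 2) * n ^ k := Nat.mul_le_mul_right _ h3
        _ = 3 * (k + 1) * n ^ k * n ^ 2 := by ring
    calc q * ((k + 1) * ((n + 1) ^ 2 - 2) * n ^ k + 2 * n ^ (k + 1))
        ≤ q * (3 * (k + 1) * n ^ k * n ^ 2) := Nat.mul_le_mul_left q h1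
      _ = 3 * (k + 1) * q * (n ^ k * n ^ 2) := by ring
      _ < n ^ k * (n ^ k * n ^ 2) := Nat.mul_lt_mul_of_pos_right hq' (by positivity)
      _ = (n ^ (k + 1)) ^ 2 := by ring)
  refine not_solvable_two_of_haven s hR.preconnected hK fun Q hQ => ?_
  rw [← Set.one_lt_ncard_iff_nontrivial]
  have h1 := hK2 Q hQ
  rw [hcard] at h1
  have h2 : 2 ^ 1 ≤ n ^ (k + 1) := (Nat.pow_le_pow_left hn 1).trans
    (Nat.pow_le_pow_right (by omega) (by omega))
  omega

theorem le_h_two_A {d n : ℕ} (hd : 1 ≤ d) (hn : 2 ≤ n) (s : Fin d → Fin n) :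
    (n : ℝ) ^ (d - 1) / (3 * (d : ℝ)) ≤ h .two .A (grid d n) s :=
  (le_h_two_B hd hn s).trans (Nat.cast_le.2 (Nat.sInf_le (solvable_h .two .A _ s).of_A))

/-! ### Setting 1: permutations and blocks of four vertices -/

/-- The digraph with the edges from `v` to `σ v`, without the edge into `s`. -/
def permDigraph {V : Type u} (s : V) (σ : Equiv.Perm V) : Digraph V :=
  ⟨fun x y => σ x = y ∧ y ≠ s⟩

/-- The permutation `σ` moves every vertex along an edge, except for the one that it sends to `s`,
and has no other cycles of length two. -/
def IsGoodPerm {V : Type u} (G : SimpleGraph V) (s : V) (σ : Equiv.Perm V) : Prop :=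
  ∀ v, σ v ≠ s → G.Adj v (σ v) ∧ σ (σ v) ≠ v

/-- Closing the path by a fictitious edge from its end to `s` turns a digraph of Setting 1 into a
permutation; bijectivity then takes care of all degrees. -/
theorem IsGoodPerm.valid {V : Type u} {G : SimpleGraph V} {s : V} {σ : Equiv.Perm V}
    (hσ : IsGoodPerm G s σ) : Setting.one.Valid G s (permDigraph s σ) := by
  refine ⟨⟨?_, ?_, ?_, ?_⟩, fun v hv => ⟨σ.symm v, ⟨by simp, hv⟩, ?_⟩⟩
  · rintro x y ⟨rfl, hy⟩
    exact (hσ x hy).1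
  · rintro x y ⟨rfl, hy⟩ ⟨h, -⟩
    exact (hσ x hy).2 h
  · rintro x y z ⟨rfl, -⟩ ⟨h, -⟩
    exact h
  · rintro x ⟨-, h⟩
    exact h rfl
  · rintro x ⟨rfl, -⟩
    simp

theorem apply_end_permDigraph {V : Type u} {s t : V} {σ : Equiv.Perm V}
    (ht : (permDigraph s σ).IsEndFrom s t) : σ t = s := by
  by_contra h
  exact ht.2 (σ t) ⟨rfl, h⟩

/-- Reversing the last three edges of the path, when its last four vertices form a cycle. -/
theorem IsGoodPerm.exists_flip {V : Type u} {G : SimpleGraph V} {s a b c d : V}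
    {σ : Equiv.Perm V} (hσ : IsGoodPerm G s σ) (hab : σ a = b) (hbc : σ b = c) (hcd : σ c = d)
    (hds : σ d = s) (hnd : [a, b, c, d].Nodup) (hda : G.Adj d a) :
    ∃ σ' : Equiv.Perm V, IsGoodPerm G s σ' ∧ σ' b = s ∧
      ∀ v, v ∉ [a, b, c, d] → σ' v = σ v := by
  classical
  simp only [List.nodup_cons, List.mem_cons, not_or, List.not_mem_nil, not_false_eq_true,
    List.nodup_nil, and_true] at hnd
  obtain ⟨⟨n1, n2, n3⟩, ⟨n4, n5⟩, n6⟩ := hnd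
  have hbs : b ≠ s := fun h => n3 (σ.injective (by rw [hab, hds, h]))
  have hcs : c ≠ s := fun h => n5 (σ.injective (by rw [hbc, hds, h]))
  have hdns : d ≠ s := fun h => n6 (σ.injective (by rw [hcd, hds, h]))
  have gbc := (hσ b (by rw [hbc]; exact hcs)).1
  have gcd := (hσ c (by rw [hcd]; exact hdns)).1
  rw [hbc] at gbc
  rw [hcd] at gcd
  -- Conjugation by this transposition turns the final piece `a, b, c, d` into `a, d, c, b`.
  set ρ := Equiv.swap b d with hρ
  have ra : ρ a = a := Equiv.swap_apply_of_ne_of_ne n1 n3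
  have rb : ρ b = d := Equiv.swap_apply_left b d
  have rc : ρ c = c := Equiv.swap_apply_of_ne_of_ne (Ne.symm n4) n6
  have rd : ρ d = b := Equiv.swap_apply_right b d
  have rs : ρ s = s := Equiv.swap_apply_of_ne_of_ne hbs.symm hdns.symm
  have ea : (ρ * σ * ρ) a = d := by simp [ra, hab, rb]
  have ed : (ρ * σ * ρ) d = c := by simp [rd, hbc, rc]
  have ec : (ρ * σ * ρ) c = b := by simp [rc, hcd, rd]
  have eb : (ρ * σ * ρ) b = s := by simp [rb, hds, rs]
  have ev : ∀ v, v ∉ [a, b, c, d] → (ρ * σ * ρ) v = σ v := by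
    intro v hv
    simp only [List.mem_cons, not_or, List.not_mem_nil, not_false_eq_true, and_true] at hv
    obtain ⟨v1, v2, v3, v4⟩ := hv
    have h1 : ρ v = v := Equiv.swap_apply_of_ne_of_ne v2 v4
    have h2 : ρ (σ v) = σ v := Equiv.swap_apply_of_ne_of_ne
      (fun h => v1 (σ.injective (h.trans hab.symm))) (fun h => v3 (σ.injective (h.trans hcd.symm)))
    simp [h1, h2]
  refine ⟨ρ * σ * ρ, fun v hv => ?_, eb, ev⟩
  by_cases hva : v = a
  · subst hva
    rw [ea, ed]
    exact ⟨hda.symm, Ne.symm n2⟩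
  by_cases hvb : v = b
  · subst hvb
    exact absurd eb hv
  by_cases hvc : v = c
  · subst hvc
    rw [ec, eb]
    exact ⟨gbc.symm, hcs.symm⟩
  by_cases hvd : v = d
  · subst hvd
    rw [ed, ec]
    exact ⟨gcd.symm, n5⟩
  have hv' : v ∉ [a, b, c, d] := by simp [hva, hvb, hvc, hvd]
  rw [ev v hv'] at hv ⊢
  refine ⟨(hσ v hv).1, ?_⟩
  by_cases hm : σ v ∈ [a, b, c, d]
  · simp only [List.mem_cons, List.not_mem_nil, or_false] at hm
    rcases hm with hm | hm | hm | hm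
    · rw [hm, ea]
      exact Ne.symm hvd
    · exact absurd (σ.injective (hm.trans hab.symm)) hva
    · exact absurd (σ.injective (hm.trans hbc.symm)) hvb
    · exact absurd (σ.injective (hm.trans hcd.symm)) hvc
  · rw [ev _ hm]
    exact (hσ v hv).2

/-- Attaching a cycle, cut open at its edge from `a` to `c`, to the end `t` of the path. -/
theorem IsGoodPerm.exists_extend {V : Type u} {G : SimpleGraph V} {s t a c : V}
    {σ : Equiv.Perm V} (hσ : IsGoodPerm G s σ) (hts : σ t = s) (hac : σ a = c) (hadj : G.Adj t c)
    (hta : a ≠ t) (hct : σ c ≠ t) (hsa : σ s ≠ a) :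
    ∃ σ' : Equiv.Perm V, IsGoodPerm G s σ' ∧ σ' t = c ∧ σ' a = s ∧
      ∀ v, v ≠ t → v ≠ a → σ' v = σ v := by
  classical
  -- Composing with the transposition exchanges the successors of `t` and `a`. The hypotheses `hct`
  -- and `hsa` exclude the opposite edges this could create, between `t` and `c` and between `s` and
  -- `a`.
  have et : (σ * Equiv.swap t a) t = c := by simp [hac]
  have ea : (σ * Equiv.swap t a) a = s := by simp [hts]
  have ev : ∀ v, v ≠ t → v ≠ a → (σ * Equiv.swap t a) v = σ v := by
    intro v h1 h2
    simp [Equiv.swap_apply_of_ne_of_ne h1 h2]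
  have hcs : c ≠ s := fun h => hta (σ.injective (by rw [hac, hts, h]))
  have hca : c ≠ a := by
    have h := (hσ a (hac ▸ hcs)).1
    rw [hac] at h
    exact h.ne'
  refine ⟨σ * Equiv.swap t a, fun v hv => ?_, et, ea, ev⟩
  by_cases hvt : v = t
  · subst hvt
    rw [et, ev c hadj.ne' hca]
    exact ⟨hadj, hct⟩
  by_cases hva : v = a
  · subst hva
    exact absurd ea hv
  rw [ev v hvt hva] at hv ⊢
  refine ⟨(hσ v hv).1, ?_⟩
  by_cases h1 : σ v = t
  · rw [h1, et]
    rintro rfl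
    exact hct h1
  by_cases h2 : σ v = a
  · rw [h2, ea]
    rintro rfl
    exact hsa h2
  rw [ev _ h1 h2]
  exact (hσ v hv).2

/-- Since edges of `σ` never leave `B`, the predecessor of a vertex `v ≠ s` outside `B` is also
outside `B`, where both permutations agree. So incoming edges at `v` are unchanged as well. -/
theorem answerB_permDigraph_eq {V : Type u} {s : V} {σ σ' : Equiv.Perm V} {B : Set V}
    (hB : ∀ v ∈ B, σ v ∈ B ∨ σ v = s) (hag : ∀ v, v ∉ B → σ' v = σ v) {v : V} (hv : v ∉ B) :
    answerB (permDigraph s σ') v = answerB (permDigraph s σ) v := by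
  have hpre : ∀ x, σ x = v → v ≠ s → x ∉ B := by
    rintro x rfl hs hx
    exact (hB x hx).elim hv hs
  ext ⟨x, y⟩
  simp only [answerB, permDigraph, Set.mem_ofPred_eq]
  constructor
  · rintro ⟨⟨h1, h2⟩, rfl | rfl⟩
    · exact ⟨⟨by rw [← h1, hag _ hv], h2⟩, Or.inl rfl⟩
    · refine ⟨⟨?_, h2⟩, Or.inr rfl⟩
      have h3 := hag _ (hpre (σ.symm y) (by simp) h2)
      rw [Equiv.apply_symm_apply] at h3
      rw [σ'.injective (h1.trans h3.symm), Equiv.apply_symm_apply]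
  · rintro ⟨⟨h1, h2⟩, rfl | rfl⟩
    · exact ⟨⟨by rw [← h1, hag _ hv], h2⟩, Or.inl rfl⟩
    · exact ⟨⟨by rw [← h1, hag _ (hpre _ h1 h2)], h2⟩, Or.inr rfl⟩

/-- Disjoint cycles of length four in `G`, indexed by the vertices of `H`. A path that enters a
cycle at any vertex can cover it and leave it towards any neighbour in `H`. -/
structure IsCycleBlocks {V : Type u} {W : Type w} (G : SimpleGraph V) (H : SimpleGraph W)
    (b : W → ZMod 4 → V) : Prop where
  inj : ∀ w w' i i', b w i = b w' i' → w = w' ∧ i = i'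
  adj : ∀ w i, G.Adj (b w i) (b w (i + 1))
  exit : ∀ w w', H.Adj w w' → ∀ i, ∃ j i', (j = i + 1 ∨ j = i + 3) ∧ G.Adj (b w j) (b w' i')

/-- The path ends with all vertices of the block `w`, and the other blocks of `C` are cycles. -/
def BlockInv {V : Type u} {W : Type w} (G : SimpleGraph V) (s : V) (b : W → ZMod 4 → V)
    (C : Set W) (w : W) (D : Digraph V) : Prop :=
  ∃ (σ : Equiv.Perm V) (x : ZMod 4), IsGoodPerm G s σ ∧ D = permDigraph s σ ∧
    σ (b w x) = b w (x + 1) ∧ σ (b w (x + 1)) = b w (x + 2) ∧ σ (b w (x + 2)) = b w (x + 3) ∧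
    σ (b w (x + 3)) = s ∧ ∀ c ∈ C, c ≠ w → ∀ i, σ (b c i) = b c (i + 1)

theorem zmod_four_cases (x i : ZMod 4) : i = x ∨ i = x + 1 ∨ i = x + 2 ∨ i = x + 3 := by
  revert x i
  decide

/-- Both neighbours of the entry `x` in the block `w` can be made the end of the path. -/
theorem exists_end_of_block {V : Type u} {W : Type w} {G : SimpleGraph V} {H : SimpleGraph W}
    {s : V} {b : W → ZMod 4 → V} (hb : IsCycleBlocks G H b) {σ : Equiv.Perm V}
    (hσ : IsGoodPerm G s σ) {w : W} {x : ZMod 4} (h0 : σ (b w x) = b w (x + 1))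
    (h1 : σ (b w (x + 1)) = b w (x + 2)) (h2 : σ (b w (x + 2)) = b w (x + 3))
    (h3 : σ (b w (x + 3)) = s) {j : ZMod 4} (hj : j = x + 1 ∨ j = x + 3) :
    ∃ σ' : Equiv.Perm V, IsGoodPerm G s σ' ∧ σ' (b w j) = s ∧
      ∀ v, (∀ i, v ≠ b w i) → σ' v = σ v := by
  rcases hj with rfl | rfl
  · have hadj : G.Adj (b w (x + 3)) (b w x) := by
      have h4 := hb.adj w (x + 3)
      have h5 : x + 3 + 1 = x := by clear * -; revert x; decide
      rwa [h5] at h4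
    have hne : ∀ i i', i ≠ i' → b w i ≠ b w i' := fun i i' hi h => hi (hb.inj _ _ _ _ h).2
    obtain ⟨σ', h4, h5, h6⟩ := hσ.exists_flip h0 h1 h2 h3 (by
      simp only [List.nodup_cons, List.mem_cons, not_or, List.not_mem_nil, not_false_eq_true,
        List.nodup_nil, and_true]
      refine ⟨⟨hne _ _ ?_, hne _ _ ?_, hne _ _ ?_⟩, ⟨hne _ _ ?_, hne _ _ ?_⟩, hne _ _ ?_⟩ <;>
        (clear * -; revert x; decide)) hadj
    exact ⟨σ', h4, h5, fun v hv => h6 v (by simp [hv])⟩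
  · exact ⟨σ, hσ, h3, fun _ _ => rfl⟩

theorem blockInv_closed {V : Type u} {W : Type w} {s : V} {b : W → ZMod 4 → V}
    {σ : Equiv.Perm V} {C : Set W} {w : W} {x : ZMod 4} (hw : w ∈ C)
    (h0 : σ (b w x) = b w (x + 1)) (h1 : σ (b w (x + 1)) = b w (x + 2))
    (h2 : σ (b w (x + 2)) = b w (x + 3)) (h3 : σ (b w (x + 3)) = s)
    (hC : ∀ c ∈ C, c ≠ w → ∀ i, σ (b c i) = b c (i + 1)) :
    ∀ v ∈ {v | ∃ c ∈ C, ∃ i, v = b c i}, σ v ∈ {v | ∃ c ∈ C, ∃ i, v = b c i} ∨ σ v = s := by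
  rintro v ⟨c, hc, i, rfl⟩
  by_cases hcw : c = w
  · subst hcw
    rcases zmod_four_cases x i with rfl | rfl | rfl | rfl
    · exact Or.inl ⟨c, hc, _, h0⟩
    · exact Or.inl ⟨c, hc, _, h1⟩
    · exact Or.inl ⟨c, hc, _, h2⟩
    · exact Or.inr h3
  · exact Or.inl ⟨c, hc, _, hC c hc hcw i⟩

/-- The predecessor of `s` under `σ` is `t`; if `s` were on an untouched cycle, `t` would be on it
too. -/
theorem source_notMem_block {V : Type u} {W : Type w} {s t : V} {b : W → ZMod 4 → V} {σ : Equiv.Perm V} {c : W}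
    (hts : σ t = s) (ht : ∀ i, t ≠ b c i) (hc : ∀ i, σ (b c i) = b c (i + 1)) (i : ZMod 4) :
    s ≠ b c i := by
  intro h
  have h1 := hc (i - 1)
  rw [sub_add_cancel, ← h, ← hts] at h1
  exact ht _ (σ.injective h1).symm

/-- The path enters an untouched block and covers it. -/
theorem blockInv_extend {V : Type u} {W : Type w} {G : SimpleGraph V} {H : SimpleGraph W}
    {s t : V} {b : W → ZMod 4 → V} (hb : IsCycleBlocks G H b) {σ : Equiv.Perm V}
    (hσ : IsGoodPerm G s σ) {C : Set W} {w : W} {i : ZMod 4} (hw : ∀ i, σ (b w i) = b w (i + 1))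
    (hts : σ t = s) (ht : ∀ c ∈ C, ∀ i, t ≠ b c i) (hwC : w ∈ C) (hadj : G.Adj t (b w i))
    (hC : ∀ c ∈ C, c ≠ w → ∀ i, σ (b c i) = b c (i + 1)) :
    ∃ σ' : Equiv.Perm V, BlockInv G s b C w (permDigraph s σ') ∧
      ∀ v, v ≠ t → (∀ i, v ≠ b w i) → σ' v = σ v := by
  have hs := source_notMem_block hts (ht w hwC) hw
  have hi : i + 3 + 1 = i := by clear * -; revert i; decide
  have hi2 : i + 2 + 1 = i + 3 := by ring
  have hi1 : i + 1 + 1 = i + 2 := by ring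
  have hne : ∀ i i', i ≠ i' → b w i ≠ b w i' := fun i i' hi h => hi (hb.inj _ _ _ _ h).2
  obtain ⟨σ', h1, h2, h3, h4⟩ := hσ.exists_extend hts (a := b w (i + 3)) (c := b w i)
    (by rw [hw, hi]) hadj (Ne.symm (ht w hwC _)) (by rw [hw]; exact Ne.symm (ht w hwC _))
    (fun h => hs (i + 2) (σ.injective (by rw [h, hw, hi2])))
  refine ⟨σ', ⟨σ', i, h1, rfl, ?_, ?_, ?_, h3, ?_⟩, fun v hv hv' => h4 v hv (hv' _)⟩
  · rw [h4 _ (Ne.symm (ht w hwC _)) (hne _ _ (by clear * -; revert i; decide)), hw]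
  · rw [h4 _ (Ne.symm (ht w hwC _)) (hne _ _ (by clear * -; revert i; decide)), hw, hi1]
  · rw [h4 _ (Ne.symm (ht w hwC _)) (hne _ _ (by clear * -; revert i; decide)), hw, hi2]
  · intro c hc hcw i'
    rw [h4 _ (Ne.symm (ht c hc _)) (fun h => hcw (hb.inj _ _ _ _ h).1), hC c hc hcw]

theorem BlockInv.mono {V : Type u} {W : Type w} {G : SimpleGraph V} {s : V} {b : W → ZMod 4 → V}
    {C C' : Set W} {w : W} {D : Digraph V} (hC : C' ⊆ C) (h : BlockInv G s b C w D) :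
    BlockInv G s b C' w D := by
  obtain ⟨σ, x, h1, h2, h3, h4, h5, h6, h7⟩ := h
  exact ⟨σ, x, h1, h2, h3, h4, h5, h6, fun c hc => h7 c (hC hc)⟩

/-- To move to `w'`, the end is first placed at a neighbour of the entry from which `w'` can be
reached, by a flip if necessary; then the cycle of `w'` is absorbed. -/
theorem isSupply_blockInv {V : Type u} {W : Type w} {G : SimpleGraph V} {H : SimpleGraph W}
    (s : V) {b : W → ZMod 4 → V} (hb : IsCycleBlocks G H b) {blk : V → Option W}
    (hblk : ∀ w i, blk (b w i) = some w) : IsSupply .one G s H blk (BlockInv G s b) where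
  valid := by
    rintro C w D ⟨σ, x, hσ, rfl, -⟩
    exact hσ.valid
  mono := fun _ _ _ _ hC h => h.mono hC
  move := by
    rintro C w w' D ⟨σ, x, hσ, rfl, h0, h1, h2, h3, hC⟩ hw hw' hadj
    obtain ⟨j, i', hj, hji⟩ := hb.exit w w' hadj x
    obtain ⟨σ₁, hσ₁, hend, hag₁⟩ := exists_end_of_block hb hσ h0 h1 h2 h3 hj
    have hC₁ : ∀ c ∈ C, c ≠ w → ∀ i, σ₁ (b c i) = b c (i + 1) := by
      intro c hc hcw i
      rw [hag₁ _ fun i' h => hcw (hb.inj _ _ _ _ h).1, hC c hc hcw]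
    obtain ⟨σ₂, hinv, hag₂⟩ := blockInv_extend hb hσ₁ (C := C \ {w}) (w := w') (i := i')
      (hC₁ w' hw' hadj.ne') hend (fun c hc i h => hc.2 (hb.inj _ _ _ _ h).1.symm)
      ⟨hw', hadj.ne'⟩ hji (fun c hc _ => hC₁ c hc.1 hc.2)
    refine ⟨_, hinv, fun v hv => answerB_permDigraph_eq (blockInv_closed hw h0 h1 h2 h3 hC) ?_ ?_⟩
    · intro v hv
      rw [hag₂ v (fun h => hv ⟨w, hw, _, h⟩) (fun i h => hv ⟨w', hw', i, h⟩),
        hag₁ v fun i h => hv ⟨w, hw, i, h⟩]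
    · rintro ⟨c, hc, i, rfl⟩
      exact hv c hc (hblk c i)

/-- The flip alone makes the end ambiguous inside one block, so the haven need not have two
elements. -/
theorem not_solvable_one_of_haven {V : Type u} {W : Type w} {G : SimpleGraph V}
    {H : SimpleGraph W} (s : V) {b : W → ZMod 4 → V} (hb : IsCycleBlocks G H b) {q : ℕ}
    {K : Set W → Set W} (hH : H.Preconnected) (hK : IsHaven H q K) {w₀ : W} {D₀ : Digraph V}
    (hD₀ : BlockInv G s b Set.univ w₀ D₀) : ¬ Solvable .one .B G s q := by
  classical
  obtain ⟨blk, hblk⟩ : ∃ blk : V → Option W, ∀ w i, blk (b w i) = some w := by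
    refine ⟨fun v => if h : ∃ w i, b w i = v then some h.choose else none, fun w i => ?_⟩
    have hex : ∃ w' i', b w' i' = b w i := ⟨w, i, rfl⟩
    change dite (∃ w' i', b w' i' = b w i) _ _ = _
    rw [dif_pos hex]
    obtain ⟨i', hi'⟩ := hex.choose_spec
    rw [(hb.inj _ _ _ _ hi').1]
  refine (isSupply_blockInv s hb hblk).not_solvable hK hH ?_ hD₀
  rintro Q w D t - hw ⟨σ, x, hσ, rfl, h0, h1, h2, h3, hC⟩ ht
  obtain ⟨σ', hσ', hend, hag⟩ := exists_end_of_block hb hσ h0 h1 h2 h3 (j := x + 1) (Or.inl rfl)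
  refine ⟨_, hσ'.valid, fun ht' => ?_, fun v hv =>
    answerB_permDigraph_eq (blockInv_closed hw h0 h1 h2 h3 hC) ?_ ?_⟩
  · have e1 : t = b w (x + 3) := σ.injective ((apply_end_permDigraph ht).trans h3.symm)
    have e2 : t = b w (x + 1) := σ'.injective ((apply_end_permDigraph ht').trans hend.symm)
    have e3 := (hb.inj _ _ _ _ (e1.symm.trans e2)).2
    clear * - e3
    revert x
    decide
  · exact fun v hv => hag v fun i h => hv ⟨w, hw, i, h⟩
  · rintro ⟨c, hc, i, rfl⟩
    exact hv c hc (hblk c i)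

/-! ### The 2 × 2 squares of the grid -/

/-- The grid vertex with the first two coordinates `x` and `y`. -/
def gridVertex {k n : ℕ} (x y : Fin n) (z : Fin k → Fin n) : Fin (k + 2) → Fin n :=
  Fin.cons x (Fin.cons y z)

theorem gridVertex_inj {k n : ℕ} {x y x' y' : Fin n} {z z' : Fin k → Fin n} :
    gridVertex x y z = gridVertex x' y' z' ↔ x = x' ∧ y = y' ∧ z = z' := by
  simp [gridVertex, Fin.cons_inj]

theorem exists_eq_gridVertex {k n : ℕ} (v : Fin (k + 2) → Fin n) :
    ∃ x y z, v = gridVertex x y z :=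
  ⟨v 0, v 1, fun i => v i.succ.succ, by
    funext i
    refine Fin.cases rfl (fun i => ?_) i
    refine Fin.cases rfl (fun i => rfl) i⟩

theorem grid_adj_fst {k n : ℕ} {x x' y : Fin n} {z : Fin k → Fin n}
    (h : (x : ℕ) + 1 = x' ∨ (x' : ℕ) + 1 = x) :
    (grid (k + 2) n).Adj (gridVertex x y z) (gridVertex x' y z) := by
  refine ⟨0, h, fun j hj => ?_⟩
  obtain ⟨j, rfl⟩ := Fin.exists_succ_eq.2 hj
  rfl

theorem grid_adj_snd {k n : ℕ} {x y y' : Fin n} {z : Fin k → Fin n}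
    (h : (y : ℕ) + 1 = y' ∨ (y' : ℕ) + 1 = y) :
    (grid (k + 2) n).Adj (gridVertex x y z) (gridVertex x y' z) := by
  refine ⟨1, h, fun j hj => ?_⟩
  induction j using Fin.cases with
  | zero => rfl
  | succ j =>
    induction j using Fin.cases with
    | zero => exact absurd rfl hj
    | succ j => rfl

theorem grid_adj_rest {k n : ℕ} {x y : Fin n} {z z' : Fin k → Fin n} (h : (grid k n).Adj z z') :
    (grid (k + 2) n).Adj (gridVertex x y z) (gridVertex x y z') := by
  obtain ⟨i, hi, hne⟩ := h
  refine ⟨i.succ.succ, hi, fun j hj => ?_⟩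
  induction j using Fin.cases with
  | zero => rfl
  | succ j =>
    induction j using Fin.cases with
    | zero => rfl
    | succ j => exact hne j fun h => hj (h ▸ rfl)

/-- The first coordinate of the vertices of a square, in cyclic order. -/
def squareFst (i : ZMod 4) : ℕ := if i = 1 ∨ i = 2 then 1 else 0

/-- The second coordinate of the vertices of a square, in cyclic order. -/
def squareSnd (i : ZMod 4) : ℕ := if i = 2 ∨ i = 3 then 1 else 0

theorem squareFst_le (i : ZMod 4) : squareFst i ≤ 1 := by revert i; decide

theorem squareSnd_le (i : ZMod 4) : squareSnd i ≤ 1 := by revert i; decide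

/-- The vertices of the two-dimensional square `w`, where the first coordinate is shifted
by `o`. -/
def squareVertex {k m o n : ℕ} (hn : n = 2 * m + o) (w : (Fin m × Fin m) × (Fin k → Fin n))
    (i : ZMod 4) : Fin (k + 2) → Fin n :=
  gridVertex ⟨2 * w.1.1 + o + squareFst i, by have := squareFst_le i; omega⟩
    ⟨2 * w.1.2 + squareSnd i, by have := squareSnd_le i; omega⟩ w.2

/-- The graph of the squares. -/
abbrev squareGraph (k m n : ℕ) : SimpleGraph ((Fin m × Fin m) × (Fin k → Fin n)) :=
  ((SimpleGraph.pathGraph m).boxProd (SimpleGraph.pathGraph m)).boxProd (grid k n)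

theorem hasRouting_squareGraph (k m n : ℕ) :
    HasRouting (squareGraph k m n) (((((m + 1) ^ 2 - 2) * m + ((m + 1) ^ 2 - 2) * m)) * n ^ k +
      (k * ((n + 1) ^ 2 - 2) * n ^ (k - 1) + 2 * n ^ k) * (m * m)) := by
  have h1 := (hasRouting_pathGraph m).prod
    (H := (SimpleGraph.pathGraph m).boxProd (SimpleGraph.pathGraph m)) (Equiv.refl _)
    (hasRouting_pathGraph m)
    (fun x x' y h => SimpleGraph.boxProd_adj.2 (Or.inl ⟨h, rfl⟩))
    (fun x y y' h => SimpleGraph.boxProd_adj.2 (Or.inr ⟨h, rfl⟩))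
  have h2 := h1.prod (H := squareGraph k m n) (Equiv.refl _) (hasRouting_grid k n)
    (fun x x' y h => SimpleGraph.boxProd_adj.2 (Or.inl ⟨h, rfl⟩))
    (fun x y y' h => SimpleGraph.boxProd_adj.2 (Or.inr ⟨h, rfl⟩))
  simpa using h2

/-- For `exit`: the two cyclic neighbours of a corner are opposite corners, so each side of the
square contains one of them. Towards a parallel square in another coordinate, every corner has a
neighbour. -/
theorem isCycleBlocks_squareVertex {k m o n : ℕ} (hn : n = 2 * m + o) :
    IsCycleBlocks (grid (k + 2) n) (squareGraph k m n) (squareVertex hn) where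
  inj := by
    rintro ⟨⟨X, Y⟩, z⟩ ⟨⟨X', Y'⟩, z'⟩ i i' h
    simp only [squareVertex, gridVertex_inj, Fin.mk.injEq] at h
    obtain ⟨h1, h2, rfl⟩ := h
    have a1 := squareFst_le i
    have a2 := squareFst_le i'
    have a3 := squareSnd_le i
    have a4 := squareSnd_le i'
    obtain rfl : X = X' := Fin.ext (by omega)
    obtain rfl : Y = Y' := Fin.ext (by omega)
    refine ⟨rfl, ?_⟩
    have key : ∀ i i' : ZMod 4, squareFst i = squareFst i' → squareSnd i = squareSnd i' → i = i' :=
      by decide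
    exact key i i' (by omega) (by omega)
  adj := by
    intro w i
    have key : ∀ i : ZMod 4, (squareFst (i + 1) = squareFst i ∧
        (squareSnd i + 1 = squareSnd (i + 1) ∨ squareSnd (i + 1) + 1 = squareSnd i)) ∨
        (squareSnd (i + 1) = squareSnd i ∧
        (squareFst i + 1 = squareFst (i + 1) ∨ squareFst (i + 1) + 1 = squareFst i)) := by decide
    simp only [squareVertex]
    rcases key i with ⟨h1, h2⟩ | ⟨h1, h2⟩
    · simp only [h1]
      exact grid_adj_snd (by simp only; omega)
    · simp only [h1]
      exact grid_adj_fst (by simp only; omega)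
  exit := by
    rintro ⟨⟨X, Y⟩, z⟩ ⟨⟨X', Y'⟩, z'⟩ h i
    have kF : ∀ (a : Fin 2) (i : ZMod 4), ∃ j, (j = i + 1 ∨ j = i + 3) ∧ squareFst j = a := by
      decide
    have kS : ∀ (a : Fin 2) (i : ZMod 4), ∃ j, (j = i + 1 ∨ j = i + 3) ∧ squareSnd j = a := by
      decide
    have kF' : ∀ (a : Fin 2) (j : ZMod 4), ∃ i, squareFst i = a ∧ squareSnd i = squareSnd j := by
      decide
    have kS' : ∀ (a : Fin 2) (j : ZMod 4), ∃ i, squareSnd i = a ∧ squareFst i = squareFst j := by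
      decide
    simp only [SimpleGraph.boxProd_adj, SimpleGraph.pathGraph_adj, Prod.mk.injEq] at h
    rcases h with ⟨⟨h | h, rfl⟩ | ⟨h | h, rfl⟩, rfl⟩ | ⟨h, rfl, rfl⟩
    · obtain ⟨j, hj, hj1⟩ := kF 1 i
      obtain ⟨i', hi1, hi2⟩ := kF' 0 j
      refine ⟨j, i', hj, ?_⟩
      simp only [squareVertex, hi2, hj1, hi1]
      exact grid_adj_fst (by simp; omega)
    · obtain ⟨j, hj, hj1⟩ := kF 0 i
      obtain ⟨i', hi1, hi2⟩ := kF' 1 j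
      refine ⟨j, i', hj, ?_⟩
      simp only [squareVertex, hi2, hj1, hi1]
      exact grid_adj_fst (by simp; omega)
    · obtain ⟨j, hj, hj1⟩ := kS 1 i
      obtain ⟨i', hi1, hi2⟩ := kS' 0 j
      refine ⟨j, i', hj, ?_⟩
      simp only [squareVertex, hi2, hj1, hi1]
      exact grid_adj_snd (by simp; omega)
    · obtain ⟨j, hj, hj1⟩ := kS 0 i
      obtain ⟨i', hi1, hi2⟩ := kS' 1 j
      refine ⟨j, i', hj, ?_⟩
      simp only [squareVertex, hi2, hj1, hi1]
      exact grid_adj_snd (by simp; omega)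
    · exact ⟨i + 1, i + 1, Or.inl rfl, grid_adj_rest h⟩

theorem exists_perm_of_injective {α V : Type*} {r : α → V} (hr : Function.Injective r)
    (F : Equiv.Perm α) :
    ∃ σ : Equiv.Perm V, (∀ a, σ (r a) = r (F a)) ∧ ∀ v, (∀ a, v ≠ r a) → σ v = v := by
  classical
  refine ⟨F.extendDomain (Equiv.ofInjective r hr), fun a => ?_, fun v hv => ?_⟩
  · exact F.extendDomain_apply_image (Equiv.ofInjective r hr) a
  · exact F.extendDomain_apply_not_subtype _ (by rintro ⟨a, rfl⟩; exact hv a rfl)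

/-- The permutation that rotates all squares. -/
theorem exists_rotation {k m o n : ℕ} (hn : n = 2 * m + o) :
    ∃ σ : Equiv.Perm (Fin (k + 2) → Fin n),
      (∀ w i, σ (squareVertex hn w i) = squareVertex hn w (i + 1)) ∧
      ∀ v, (∀ w i, v ≠ squareVertex hn w i) → σ v = v := by
  have hinj : Function.Injective fun p : ((Fin m × Fin m) × (Fin k → Fin n)) × ZMod 4 =>
      squareVertex hn p.1 p.2 := by
    rintro ⟨w, i⟩ ⟨w', i'⟩ h
    obtain ⟨rfl, rfl⟩ := (isCycleBlocks_squareVertex hn).inj _ _ _ _ h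
    rfl
  obtain ⟨σ, h1, h2⟩ := exists_perm_of_injective hinj
    ((Equiv.refl _).prodCongr (Equiv.addRight (1 : ZMod 4)))
  exact ⟨σ, fun w i => h1 (w, i), fun v hv => h2 v fun p => hv p.1 p.2⟩

theorem squareVertex_add_two_ne {k m o n : ℕ} (hn : n = 2 * m + o)
    (w : (Fin m × Fin m) × (Fin k → Fin n)) (i : ZMod 4) :
    squareVertex hn w (i + 1 + 1) ≠ squareVertex hn w i := by
  intro h
  have h1 := ((isCycleBlocks_squareVertex hn).inj _ _ _ _ h).2
  clear * - h1
  revert i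
  decide

/-- For even `n` the squares tile the grid. The path consists of the square of the origin, where the
rotation's edge back into `s` is dropped. -/
theorem exists_blockInv_even {k m n : ℕ} [NeZero n] (hn : n = 2 * m + 0) (hm : 1 ≤ m) :
    ∃ w₀ D₀, BlockInv (grid (k + 2) n) (origin (k + 2) n) (squareVertex hn) Set.univ w₀ D₀ := by
  obtain ⟨σ, hσ, -⟩ := exists_rotation (k := k) hn
  have hs : origin (k + 2) n =
      squareVertex hn ((⟨0, hm⟩, ⟨0, hm⟩), origin k n) (0 : ZMod 4) := by
    have h1 : origin (k + 2) n = gridVertex 0 0 (origin k n) := by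
      funext i
      refine Fin.cases rfl (fun i => ?_) i
      refine Fin.cases rfl (fun i => rfl) i
    rw [h1, squareVertex, gridVertex_inj]
    have h2 : squareFst 0 = 0 := rfl
    have h3 : squareSnd 0 = 0 := rfl
    exact ⟨Fin.ext (by simp [h2]), Fin.ext (by simp [h3]), rfl⟩
  refine ⟨((⟨0, hm⟩, ⟨0, hm⟩), origin k n), _, σ, 0, ?_, rfl, hσ _ _, hσ _ _, hσ _ _, ?_,
    fun c _ _ i => hσ c i⟩
  · intro v _
    obtain ⟨x, y, z, rfl⟩ := exists_eq_gridVertex v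
    have hx := x.2
    have hy := y.2
    have hsq : ∀ a b : Fin 2, ∃ i, squareFst i = a ∧ squareSnd i = b := by decide
    obtain ⟨i, h1, h2⟩ := hsq ⟨x % 2, by omega⟩ ⟨y % 2, by omega⟩
    have hv : gridVertex x y z =
        squareVertex hn ((⟨x / 2, by omega⟩, ⟨y / 2, by omega⟩), z) i := by
      rw [squareVertex, gridVertex_inj]
      exact ⟨Fin.ext (by simp only [h1]; omega), Fin.ext (by simp only [h2]; omega), rfl⟩
    rw [hv, hσ, hσ]
    exact ⟨(isCycleBlocks_squareVertex hn).adj _ _, squareVertex_add_two_ne hn _ i⟩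
  · rw [hσ, hs]
    rfl

/-! ### Odd side length: covering the leftover strip -/

/-- For odd `n`, the vertices of a grid other than the origin can be matched along edges, so that
each edge has one vertex of each of two classes. -/
theorem exists_matching (k m n : ℕ) [NeZero n] (hn : n = 2 * m + 1) :
    ∃ (τ : (Fin k → Fin n) → (Fin k → Fin n)) (c : (Fin k → Fin n) → Prop),
      c (origin k n) ∧ ∀ z, z ≠ origin k n → τ z ≠ origin k n ∧ τ (τ z) = z ∧
        (grid k n).Adj z (τ z) ∧ (c (τ z) ↔ ¬ c z) := by
  classical
  induction k with
  | zero => exact ⟨id, fun _ => True, trivial, fun z hz => absurd (Subsingleton.elim _ _) hz⟩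
  | succ k ih =>
    obtain ⟨τ, c, hc, hτ⟩ := ih
    -- The nonzero values are paired as 1–2, 3–4 and so on, which works since `n` is odd. The
    -- matching changes the first nonzero coordinate to its partner, and `c` records its parity.
    have hp : ∀ a : Fin n, ∃ a' : Fin n, a ≠ 0 →
        (a' : ℕ) = if (a : ℕ) % 2 = 1 then (a : ℕ) + 1 else a - 1 := by
      intro a
      by_cases ha : a = 0
      · exact ⟨a, fun h => absurd ha h⟩
      · refine ⟨⟨if (a : ℕ) % 2 = 1 then (a : ℕ) + 1 else a - 1, ?_⟩, fun _ => rfl⟩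
        have := a.2
        split_ifs <;> omega
    choose p hp using hp
    have hval : ∀ a : Fin n, a ≠ 0 ↔ (a : ℕ) ≠ 0 := fun a => by
      rw [ne_eq, Fin.ext_iff]; rfl
    have hp0 : ∀ a, a ≠ 0 → p a ≠ 0 := by
      intro a ha
      rw [hval, hp a ha]
      rw [hval] at ha
      split_ifs <;> omega
    have hpp : ∀ a, a ≠ 0 → p (p a) = a := by
      intro a ha
      refine Fin.ext ?_
      rw [hp _ (hp0 a ha), hp a ha]
      rw [hval] at ha
      split_ifs <;> omega
    have hcons : ∀ (a : Fin n) (z : Fin k → Fin n),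
        (Fin.cons a z : Fin (k + 1) → Fin n) = origin (k + 1) n ↔ a = 0 ∧ z = origin k n := by
      intro a z
      have h1 : origin (k + 1) n = (Fin.cons 0 (origin k n) : Fin (k + 1) → Fin n) := by
        funext i
        refine Fin.cases rfl (fun i => rfl) i
      rw [h1, Fin.cons_inj]
    refine ⟨fun z => if z 0 ≠ 0 then Fin.cons (p (z 0)) (Fin.tail z) else
      Fin.cons (z 0) (τ (Fin.tail z)), fun z => if z 0 ≠ 0 then (z 0 : ℕ) % 2 = 1 else
      c (Fin.tail z), ?_, fun z hz => ?_⟩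
    · have h1 : origin (k + 1) n 0 = 0 := rfl
      have h2 : Fin.tail (origin (k + 1) n) = origin k n := rfl
      simpa [h1, h2] using hc
    · obtain ⟨a, z, rfl⟩ : ∃ a z', z = Fin.cons a z' :=
        ⟨z 0, Fin.tail z, (Fin.cons_self_tail z).symm⟩
      by_cases ha : a = 0
      · subst ha
        have hz' : z ≠ origin k n := fun h => hz ((hcons _ _).2 ⟨rfl, h⟩)
        obtain ⟨h1, h2, ⟨i, h3, h4⟩, h5⟩ := hτ z hz'
        simp only [Fin.cons_zero, Fin.tail_cons, ne_eq, not_true_eq_false, if_false]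
        refine ⟨fun h => h1 ((hcons _ _).1 h).2, by rw [h2], ⟨i.succ, by simpa using h3,
          fun j hj => ?_⟩, h5⟩
        induction j using Fin.cases with
        | zero => rfl
        | succ j => simpa using h4 j fun h => hj (h ▸ rfl)
      · have ha' := hp0 a ha
        simp only [Fin.cons_zero, Fin.tail_cons, ne_eq, ha, ha', not_false_eq_true, if_true]
        have hv := hp a ha
        have ha0 := (hval a).1 ha
        refine ⟨fun h => ha' ((hcons _ _).1 h).1, by rw [hpp a ha],
          ⟨0, ?_, fun j hj => ?_⟩, ?_⟩
        · simp only [Fin.cons_zero]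
          split_ifs at hv <;> omega
        · obtain ⟨j, rfl⟩ := Fin.exists_succ_eq.2 hj
          rfl
        · split_ifs at hv <;> omega

open scoped Classical in
/-- The successor on the strip `Z × {0, …, K - 1}`: forwards in the rows of the class `c`, backwards
in the other ones, and at the end of a row to the row matched to it by `τ`, or back to the beginning
of the row for the row `o`. -/
noncomputable def stripNext {Z : Type u} {K : ℕ} (τ : Z → Z) (o : Z) (c : Z → Prop)
    (p : Z × Fin K) : Z × Fin K :=
  if c p.1 then
    if h : (p.2 : ℕ) + 1 < K then (p.1, ⟨p.2 + 1, h⟩)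
    else if p.1 = o then (p.1, ⟨0, p.2.pos⟩) else (τ p.1, p.2)
  else
    if 0 < (p.2 : ℕ) then (p.1, ⟨p.2 - 1, (Nat.sub_le _ _).trans_lt p.2.2⟩)
    else if p.1 = o then (p.1, ⟨K - 1, Nat.sub_lt p.2.pos one_pos⟩) else (τ p.1, p.2)

theorem stripNext_forward {Z : Type u} {K : ℕ} {τ : Z → Z} {o : Z} {c : Z → Prop} {z : Z}
    {i j : Fin K} (hz : c z) (hij : (i : ℕ) + 1 = j) : stripNext τ o c (z, i) = (z, j) := by
  have h1 : (i : ℕ) + 1 < K := by omega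
  simp only [stripNext, hz, if_true, h1, dif_pos]
  exact Prod.ext rfl (Fin.ext hij)

theorem stripNext_backward {Z : Type u} {K : ℕ} {τ : Z → Z} {o : Z} {c : Z → Prop} {z : Z}
    {i j : Fin K} (hz : ¬ c z) (hij : (j : ℕ) + 1 = i) : stripNext τ o c (z, i) = (z, j) := by
  have h1 : 0 < (i : ℕ) := by omega
  simp only [stripNext, hz, if_false, h1, if_true]
  exact Prod.ext rfl (Fin.ext (by simp only; omega))

theorem stripNext_turn {Z : Type u} {K : ℕ} {τ : Z → Z} {o : Z} {c : Z → Prop} {z : Z} {i : Fin K}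
    (hzo : z ≠ o) (hi : (c z ∧ (i : ℕ) + 1 = K) ∨ (¬ c z ∧ (i : ℕ) = 0)) :
    stripNext τ o c (z, i) = (τ z, i) := by
  rcases hi with ⟨hz, hi⟩ | ⟨hz, hi⟩
  · have h1 : ¬ (i : ℕ) + 1 < K := by omega
    simp [stripNext, hz, h1, hzo]
  · simp [stripNext, hz, hi, hzo]

theorem stripNext_close {Z : Type u} {K : ℕ} {τ : Z → Z} {o : Z} {c : Z → Prop} {i j : Fin K}
    (hi : (c o ∧ (i : ℕ) + 1 = K ∧ (j : ℕ) = 0) ∨ (¬ c o ∧ (i : ℕ) = 0 ∧ (j : ℕ) + 1 = K)) :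
    stripNext τ o c (o, i) = (o, j) := by
  rcases hi with ⟨hz, hi, hj⟩ | ⟨hz, hi, hj⟩
  · have h1 : ¬ (i : ℕ) + 1 < K := by omega
    simp only [stripNext, hz, h1, if_true, dif_neg, not_false_eq_true]
    exact Prod.ext rfl (Fin.ext hj.symm)
  · have h1 : ¬ 0 < (i : ℕ) := by omega
    simp only [stripNext, hz, h1, if_false, if_true]
    exact Prod.ext rfl (Fin.ext (by simp only; omega))

/-- The four kinds of positions on the strip. -/
theorem strip_cases {Z : Type u} {K : ℕ} (o : Z) (c : Z → Prop) (z : Z) (i : Fin K) :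
    (c z ∧ ∃ j : Fin K, (i : ℕ) + 1 = j) ∨ (¬ c z ∧ ∃ j : Fin K, (j : ℕ) + 1 = i) ∨
    (z ≠ o ∧ ((c z ∧ (i : ℕ) + 1 = K) ∨ (¬ c z ∧ (i : ℕ) = 0))) ∨
    (z = o ∧ ∃ j : Fin K, (c o ∧ (i : ℕ) + 1 = K ∧ (j : ℕ) = 0) ∨
      (¬ c o ∧ (i : ℕ) = 0 ∧ (j : ℕ) + 1 = K)) := by
  have hi := i.2
  by_cases hc : c z
  · by_cases h : (i : ℕ) + 1 < K
    · exact Or.inl ⟨hc, ⟨i + 1, h⟩, rfl⟩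
    · right; right
      by_cases ho : z = o
      · subst ho
        exact Or.inr ⟨rfl, ⟨0, by omega⟩, Or.inl ⟨hc, by omega, rfl⟩⟩
      · exact Or.inl ⟨ho, Or.inl ⟨hc, by omega⟩⟩
  · by_cases h : 0 < (i : ℕ)
    · exact Or.inr (Or.inl ⟨hc, ⟨i - 1, by omega⟩, by simp only; omega⟩)
    · right; right
      by_cases ho : z = o
      · subst ho
        exact Or.inr ⟨rfl, ⟨K - 1, by omega⟩, Or.inr ⟨hc, by omega, by simp only; omega⟩⟩
      · exact Or.inl ⟨ho, Or.inr ⟨hc, by omega⟩⟩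

/-- Exchanging the two classes reverses the direction of every row, hence of every cycle. -/
theorem stripNext_leftInverse {Z : Type u} {K : ℕ} {τ : Z → Z} {o : Z} {c : Z → Prop}
    (hτ : ∀ z, z ≠ o → τ z ≠ o ∧ τ (τ z) = z ∧ (c (τ z) ↔ ¬ c z)) (p : Z × Fin K) :
    stripNext τ o (fun z => ¬ c z) (stripNext τ o c p) = p := by
  obtain ⟨z, i⟩ := p
  rcases strip_cases o c z i with ⟨hz, j, hj⟩ | ⟨hz, j, hj⟩ | ⟨hz, hi⟩ | ⟨rfl, j, hj⟩
  · rw [stripNext_forward hz hj, stripNext_backward (c := fun z => ¬ c z) (not_not.2 hz) hj]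
  · rw [stripNext_backward hz hj, stripNext_forward (c := fun z => ¬ c z) hz hj]
  · obtain ⟨h1, h2, h3⟩ := hτ z hz
    rw [stripNext_turn hz hi, stripNext_turn h1, h2]
    tauto
  · rw [stripNext_close hj, stripNext_close]
    tauto

/-- `stripNext` as a permutation. -/
noncomputable def stripPerm {Z : Type u} (K : ℕ) {τ : Z → Z} {o : Z} {c : Z → Prop}
    (hτ : ∀ z, z ≠ o → τ z ≠ o ∧ τ (τ z) = z ∧ (c (τ z) ↔ ¬ c z)) : Equiv.Perm (Z × Fin K) where
  toFun := stripNext τ o c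
  invFun := stripNext τ o fun z => ¬ c z
  left_inv := stripNext_leftInverse hτ
  right_inv := fun p => by
    have h1 := stripNext_leftInverse (K := K) (c := fun z => ¬ c z)
      (fun z hz => ⟨(hτ z hz).1, (hτ z hz).2.1, not_congr (hτ z hz).2.2⟩) p
    simpa using h1

/-- Two matched rows form one cycle of length `2 K`, and the row `o` closes up to a cycle of length
`K ≥ 3`. -/
theorem stripNext_stripNext_ne {Z : Type u} {K : ℕ} {τ : Z → Z} {o : Z} {c : Z → Prop}
    (hK : 3 ≤ K) (hτ : ∀ z, z ≠ o → τ z ≠ z ∧ τ z ≠ o ∧ (c (τ z) ↔ ¬ c z)) (p : Z × Fin K) :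
    stripNext τ o c (stripNext τ o c p) ≠ p := by
  obtain ⟨z, i⟩ := p
  have key : ∀ (z' : Z) (i' : Fin K) (q : Z × Fin K), q = (z', i') → (z' ≠ z ∨ (i' : ℕ) ≠ i) →
      q ≠ (z, i) := by
    rintro z' i' q rfl h h'
    obtain ⟨rfl, rfl⟩ := Prod.mk.inj h'
    simp at h
  rcases strip_cases o c z i with ⟨hz, j, hj⟩ | ⟨hz, j, hj⟩ | ⟨hz, hi⟩ | ⟨rfl, j, hj⟩
  · rw [stripNext_forward hz hj]
    rcases strip_cases o c z j with ⟨-, l, hl⟩ | ⟨h, -⟩ | ⟨hzo, hi⟩ | ⟨rfl, l, hl⟩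
    · exact key _ _ _ (stripNext_forward hz hl) (Or.inr (by omega))
    · exact absurd hz h
    · exact key _ _ _ (stripNext_turn hzo hi) (Or.inl (hτ z hzo).1)
    · refine key _ _ _ (stripNext_close hl) (Or.inr ?_)
      rcases hl with hl | hl
      · omega
      · exact absurd hz hl.1
  · rw [stripNext_backward hz hj]
    rcases strip_cases o c z j with ⟨h, -⟩ | ⟨-, l, hl⟩ | ⟨hzo, hi⟩ | ⟨rfl, l, hl⟩
    · exact absurd h hz
    · exact key _ _ _ (stripNext_backward hz hl) (Or.inr (by omega))
    · exact key _ _ _ (stripNext_turn hzo hi) (Or.inl (hτ z hzo).1)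
    · refine key _ _ _ (stripNext_close hl) (Or.inr ?_)
      rcases hl with hl | hl
      · exact absurd hl.1 hz
      · omega
  · rw [stripNext_turn hz hi]
    obtain ⟨h1, h2, h3⟩ := hτ z hz
    rcases strip_cases o c (τ z) i with ⟨h, l, hl⟩ | ⟨h, l, hl⟩ | ⟨hzo, hi'⟩ | ⟨h, -⟩
    · exact key _ _ _ (stripNext_forward h hl) (Or.inl h1)
    · exact key _ _ _ (stripNext_backward h hl) (Or.inl h1)
    · exfalso
      rcases hi with hi | hi <;> rcases hi' with hi' | hi' <;> first | tauto | omega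
    · exact absurd h h2
  · rw [stripNext_close hj]
    rcases hj with ⟨hz, hi, hj⟩ | ⟨hz, hi, hj⟩
    · refine key _ ⟨1, by omega⟩ _ (stripNext_forward hz (by simp [hj])) (Or.inr ?_)
      simp only
      omega
    · refine key _ ⟨K - 2, by omega⟩ _ (stripNext_backward hz (by simp only; omega)) (Or.inr ?_)
      simp only
      omega

/-- For `n = 2 m + 1`, the vertices outside of all squares: those with first coordinate `0` or second
coordinate `2 m`, numbered along the path formed by these two sides. -/
def stripVertex {k m n : ℕ} (hn : n = 2 * m + 1) (p : (Fin k → Fin n) × Fin (4 * m + 1)) :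
    Fin (k + 2) → Fin n :=
  gridVertex ⟨p.2 - 2 * m, by omega⟩ ⟨min p.2 (2 * m), by omega⟩ p.1

theorem stripVertex_injective {k m n : ℕ} (hn : n = 2 * m + 1) :
    Function.Injective (stripVertex (k := k) hn) := by
  rintro ⟨z, i⟩ ⟨z', i'⟩ h
  simp only [stripVertex, gridVertex_inj, Fin.mk.injEq] at h
  obtain ⟨h1, h2, rfl⟩ := h
  exact Prod.ext rfl (Fin.ext (by simp only; omega))

theorem stripVertex_ne_squareVertex {k m n : ℕ} (hn : n = 2 * m + 1)
    (p : (Fin k → Fin n) × Fin (4 * m + 1)) (w : (Fin m × Fin m) × (Fin k → Fin n)) (i : ZMod 4) :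
    stripVertex hn p ≠ squareVertex hn w i := by
  intro h
  simp only [stripVertex, squareVertex, gridVertex_inj, Fin.mk.injEq] at h
  have h1 := squareSnd_le i
  have h2 := w.1.2.2
  omega

theorem exists_eq_squareVertex_or_stripVertex {k m n : ℕ} (hn : n = 2 * m + 1)
    (v : Fin (k + 2) → Fin n) :
    (∃ w i, v = squareVertex hn w i) ∨ ∃ p, v = stripVertex hn p := by
  obtain ⟨x, y, z, rfl⟩ := exists_eq_gridVertex v
  have hx := x.2
  have hy := y.2
  by_cases h0 : (x : ℕ) = 0
  · refine Or.inr ⟨(z, ⟨y, by omega⟩), ?_⟩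
    rw [stripVertex, gridVertex_inj]
    exact ⟨Fin.ext (by simp only; omega), Fin.ext (by simp only; omega), rfl⟩
  by_cases h1 : (y : ℕ) = 2 * m
  · refine Or.inr ⟨(z, ⟨x + 2 * m, by omega⟩), ?_⟩
    rw [stripVertex, gridVertex_inj]
    exact ⟨Fin.ext (by simp only; omega), Fin.ext (by simp only; omega), rfl⟩
  have hsq : ∀ a b : Fin 2, ∃ i, squareFst i = a ∧ squareSnd i = b := by decide
  obtain ⟨i, h2, h3⟩ := hsq ⟨(x - 1) % 2, by omega⟩ ⟨y % 2, by omega⟩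
  refine Or.inl ⟨((⟨(x - 1) / 2, by omega⟩, ⟨y / 2, by omega⟩), z), i, ?_⟩
  rw [squareVertex, gridVertex_inj]
  exact ⟨Fin.ext (by simp only [h2]; omega), Fin.ext (by simp only [h3]; omega), rfl⟩

theorem stripVertex_adj {k m n : ℕ} (hn : n = 2 * m + 1) (z : Fin k → Fin n)
    {i j : Fin (4 * m + 1)} (hij : (i : ℕ) + 1 = j) :
    (grid (k + 2) n).Adj (stripVertex hn (z, i)) (stripVertex hn (z, j)) := by
  simp only [stripVertex]
  by_cases h : (j : ℕ) ≤ 2 * m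
  · have h1 : (⟨i - 2 * m, by omega⟩ : Fin n) = ⟨j - 2 * m, by omega⟩ := Fin.ext (by simp only; omega)
    rw [h1]
    exact grid_adj_snd (by simp only; omega)
  · have h1 : (⟨min i (2 * m), by omega⟩ : Fin n) = ⟨min j (2 * m), by omega⟩ :=
      Fin.ext (by simp only; omega)
    rw [h1]
    exact grid_adj_fst (by simp only; omega)

/-- The path first runs along the strip row of the origin, from `s` to the corner with first two
coordinates `(2 m, 2 m)`. This corner is adjacent to the last square of the same layer, which is
absorbed. The other strip rows form cycles in matched pairs. -/
theorem exists_blockInv_odd {k m n : ℕ} [NeZero n] (hn : n = 2 * m + 1) (hm : 1 ≤ m) :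
    ∃ w₀ D₀, BlockInv (grid (k + 2) n) (origin (k + 2) n) (squareVertex hn) Set.univ w₀ D₀ := by
  obtain ⟨τ, c, hc, hτ⟩ := exists_matching k m n hn
  obtain ⟨ρ, hρ, hρ'⟩ := exists_rotation (k := k) hn
  obtain ⟨π, hπ, hπ'⟩ := exists_perm_of_injective (stripVertex_injective (k := k) hn)
    (stripPerm (4 * m + 1) (τ := τ) (o := origin k n) (c := c)
      fun z hz => ⟨(hτ z hz).1, (hτ z hz).2.1, (hτ z hz).2.2.2⟩)
  set F := stripNext (K := 4 * m + 1) τ (origin k n) c with hF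
  have hsq : ∀ w i, (ρ * π) (squareVertex hn w i) = squareVertex hn w (i + 1) := by
    intro w i
    rw [Equiv.Perm.mul_apply, hπ' _ fun p h => stripVertex_ne_squareVertex hn p w i h.symm, hρ]
  have hst : ∀ p, (ρ * π) (stripVertex hn p) = stripVertex hn (F p) := by
    intro p
    rw [Equiv.Perm.mul_apply, hπ, hρ' _ fun w i => stripVertex_ne_squareVertex hn _ w i]
    rfl
  have hs : origin (k + 2) n = stripVertex hn (origin k n, ⟨0, by omega⟩) := by
    have h1 : origin (k + 2) n = gridVertex 0 0 (origin k n) := by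
      funext i
      refine Fin.cases rfl (fun i => ?_) i
      refine Fin.cases rfl (fun i => rfl) i
    rw [h1, stripVertex, gridVertex_inj]
    exact ⟨Fin.ext (by simp), Fin.ext (by simp), rfl⟩
  have hgood : IsGoodPerm (grid (k + 2) n) (origin (k + 2) n) (ρ * π) := by
    intro v hv
    rcases exists_eq_squareVertex_or_stripVertex hn v with ⟨w, i, rfl⟩ | ⟨⟨z, i⟩, rfl⟩
    · rw [hsq, hsq]
      exact ⟨(isCycleBlocks_squareVertex hn).adj _ _, squareVertex_add_two_ne hn _ i⟩
    · rw [hst] at hv ⊢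
      rw [hst]
      refine ⟨?_, fun h => stripNext_stripNext_ne (by omega) (fun z hz =>
        ⟨(hτ z hz).2.2.1.ne', (hτ z hz).1, (hτ z hz).2.2.2⟩) _ (stripVertex_injective hn h)⟩
      rcases strip_cases (origin k n) c z i with ⟨hz, j, hj⟩ | ⟨hz, j, hj⟩ | ⟨hz, hi⟩ | ⟨rfl, j, hj⟩
      · rw [hF, stripNext_forward hz hj]
        exact stripVertex_adj hn z hj
      · rw [hF, stripNext_backward hz hj]
        exact (stripVertex_adj hn z hj).symm
      · rw [hF, stripNext_turn hz hi]
        exact grid_adj_rest (hτ z hz).2.2.1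
      -- The step that closes the row of the origin need not be an edge of the grid, but it leads to
      -- `s` and is dropped.
      · exfalso
        refine hv ?_
        rw [hF, stripNext_close hj, hs]
        rcases hj with ⟨-, -, hj⟩ | ⟨h, -⟩
        · congr 2
          exact Fin.ext hj
        · exact absurd hc h
  set t := stripVertex hn (origin k n, (⟨4 * m, by omega⟩ : Fin (4 * m + 1))) with ht
  have hts : (ρ * π) t = origin (k + 2) n := by
    rw [ht, hst, hF, stripNext_close (j := ⟨0, by omega⟩) (Or.inl ⟨hc, rfl, rfl⟩), hs]
  have hadj : (grid (k + 2) n).Adj t (squareVertex hn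
      ((⟨m - 1, by omega⟩, ⟨m - 1, by omega⟩), origin k n) 2) := by
    have h1 : squareFst 2 = 1 := rfl
    have h2 : squareSnd 2 = 1 := rfl
    have h3 : t = gridVertex ⟨2 * (m - 1) + 1 + squareFst 2, by omega⟩ ⟨2 * m, by omega⟩
        (origin k n) := by
      rw [ht, stripVertex, gridVertex_inj]
      exact ⟨Fin.ext (by simp only; omega), Fin.ext (by simp only; omega), rfl⟩
    rw [h3]
    exact grid_adj_snd (by simp only; omega)
  obtain ⟨σ, hσ, -⟩ := blockInv_extend (isCycleBlocks_squareVertex hn) hgood (C := Set.univ)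
    (hsq _) hts (fun w _ i => stripVertex_ne_squareVertex hn _ w i) trivial hadj
    (fun w _ _ i => hsq w i)
  exact ⟨_, _, hσ⟩

/-! ### Congestion of the squares and the lower bound in Setting 1 -/

theorem square_congestion_le {k m n : ℕ} (hm : 1 ≤ m) (hn : n ≤ 3 * m) :
    n * (((((m + 1) ^ 2 - 2) * m + ((m + 1) ^ 2 - 2) * m)) * n ^ k +
      (k * ((n + 1) ^ 2 - 2) * n ^ (k - 1) + 2 * n ^ k) * (m * m)) ≤
      48 * (k + 2) * (m ^ 4 * n ^ k) := by
  have hsq : ∀ a : ℕ, (a + 1) ^ 2 - 2 ≤ 2 * a ^ 2 := by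
    intro a
    have h1 : (a + 1) ^ 2 ≤ 2 * a ^ 2 + 2 := by
      nlinarith [two_mul_le_add_sq a 1]
    omega
  have hA := hsq m
  have hB : (n + 1) ^ 2 - 2 ≤ 18 * m ^ 2 := (hsq n).trans (by nlinarith)
  set A := (m + 1) ^ 2 - 2
  set B := (n + 1) ^ 2 - 2
  -- The extra factor `n` removes the truncated exponent; for `k = 0` both sides vanish.
  have hpow : n * (k * n ^ (k - 1)) = k * n ^ k := by
    cases k with
    | zero => simp
    | succ k => simp [pow_succ]; ring
  have hnA : n * (2 * A * m) ≤ 12 * m ^ 4 := by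
    calc n * (2 * A * m) ≤ 3 * m * (2 * (2 * m ^ 2) * m) := by gcongr
      _ = 12 * m ^ 4 := by ring
  have hkB : k * B * m ^ 2 ≤ 18 * k * m ^ 4 := by
    calc k * B * m ^ 2 ≤ k * (18 * m ^ 2) * m ^ 2 := by gcongr
      _ = 18 * k * m ^ 4 := by ring
  have hn2 : 2 * n * m ^ 2 ≤ 6 * m ^ 4 := by
    calc 2 * n * m ^ 2 ≤ 2 * (3 * m) * m ^ 2 * m := by
          rw [← mul_one (2 * n * m ^ 2)]; gcongr
      _ = 6 * m ^ 4 := by ring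
  calc n * ((A * m + A * m) * n ^ k + (k * B * n ^ (k - 1) + 2 * n ^ k) * (m * m))
      = n * (2 * A * m) * n ^ k + B * m ^ 2 * (n * (k * n ^ (k - 1))) +
        2 * n * m ^ 2 * n ^ k := by ring
    _ = (n * (2 * A * m) + k * B * m ^ 2 + 2 * n * m ^ 2) * n ^ k := by rw [hpow]; ring
    _ ≤ (48 * (k + 2) * m ^ 4) * n ^ k := by
        refine Nat.mul_le_mul_right _ ?_
        nlinarith [Nat.zero_le (k * m ^ 4), Nat.zero_le (m ^ 4)]
    _ = 48 * (k + 2) * (m ^ 4 * n ^ k) := by ring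

theorem le_h_one_B {d n : ℕ} [NeZero n] (hd : 2 ≤ d) (hn : 2 ≤ n) :
    (n : ℝ) ^ (d - 1) / (48 * (d : ℝ)) ≤ h .one .B (grid d n) (origin d n) := by
  refine not_solvable_of_lt fun q hq => ?_
  obtain ⟨k, rfl⟩ : ∃ k, d = k + 2 := ⟨d - 2, by omega⟩
  have hq' : 48 * (k + 2) * q < n ^ (k + 1) := by
    rw [lt_div_iff₀ (by positivity)] at hq
    have : ((48 * (k + 2) * q : ℕ) : ℝ) < (n ^ (k + 1) : ℕ) := by
      push_cast at hq ⊢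
      linarith
    exact_mod_cast this
  have main : ∀ (m o : ℕ) (hmo : n = 2 * m + o), 1 ≤ m → o ≤ 1 →
      (∃ w₀ D₀, BlockInv (grid (k + 2) n) (origin (k + 2) n) (squareVertex hmo) Set.univ w₀ D₀) →
      ¬ Solvable .one .B (grid (k + 2) n) (origin (k + 2) n) q := by
    rintro m o hmo hm ho ⟨w₀, D₀, hD₀⟩
    have hR := hasRouting_squareGraph k m n
    have hc := square_congestion_le (k := k) hm (show n ≤ 3 * m by omega)
    obtain ⟨K, hK, -⟩ := hR.exists_haven (q := q) (by
      have hcard : Nat.card ((Fin m × Fin m) × (Fin k → Fin n)) = m * m * n ^ k := by simp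
      rw [hcard]
      generalize (((((m + 1) ^ 2 - 2) * m + ((m + 1) ^ 2 - 2) * m)) * n ^ k +
        (k * ((n + 1) ^ 2 - 2) * n ^ (k - 1) + 2 * n ^ k) * (m * m)) = C at hc
      have hn0 : 0 < n := by omega
      -- There are `m ^ 2 n ^ k` squares. The bound on `q` has one factor `n` more than their share
      -- `n ^ k`, so both sides are multiplied by `n`.
      have h1 : n * (q * C) < n * (m * m * n ^ k) ^ 2 := by
        calc n * (q * C) = q * (n * C) := by ring
          _ ≤ q * (48 * (k + 2) * (m ^ 4 * n ^ k)) := Nat.mul_le_mul_left _ hc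
          _ = 48 * (k + 2) * q * (m ^ 4 * n ^ k) := by ring
          _ < n ^ (k + 1) * (m ^ 4 * n ^ k) := Nat.mul_lt_mul_of_pos_right hq' (by positivity)
          _ = n * (m * m * n ^ k) ^ 2 := by ring
      exact Nat.lt_of_mul_lt_mul_left h1)
    exact not_solvable_one_of_haven _ (isCycleBlocks_squareVertex hmo) hR.preconnected hK hD₀
  rcases Nat.even_or_odd' n with ⟨m, hm | hm⟩
  · exact main m 0 (by omega) (by omega) (by omega) (exists_blockInv_even _ (by omega))
  · exact main m 1 hm (by omega) le_rfl (exists_blockInv_odd _ (by omega))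

end PathSearch

theorem mainTheorem1 :
    (∃ C : ℝ, 0 < C ∧ ∀ (d n : ℕ) [NeZero n], 2 ≤ d →
      (PathSearch.h .one .B (PathSearch.grid d n) (PathSearch.origin d n) : ℝ)
          ≤ C * (n : ℝ) ^ (d - 1) ∧
      (PathSearch.h .two .A (PathSearch.grid d n) (PathSearch.origin d n) : ℝ)
          ≤ C * (n : ℝ) ^ (d - 1) ∧
      (PathSearch.h .two .B (PathSearch.grid d n) (PathSearch.origin d n) : ℝ)
          ≤ C * (n : ℝ) ^ (d - 1)) ∧
    (∀ (d n : ℕ) [NeZero n], 1 ≤ d → 2 ≤ n →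
      (n : ℝ) ^ (d - 1) / (3 * (d : ℝ))
          ≤ (PathSearch.h .two .B (PathSearch.grid d n) (PathSearch.origin d n) : ℝ) ∧
      (n : ℝ) ^ (d - 1) / (3 * (d : ℝ))
          ≤ (PathSearch.h .two .A (PathSearch.grid d n) (PathSearch.origin d n) : ℝ)) ∧
    (∀ (d n : ℕ) [NeZero n], 2 ≤ d → 2 ≤ n →
      (n : ℝ) ^ (d - 1) / (48 * (d : ℝ))
          ≤ (PathSearch.h .one .B (PathSearch.grid d n) (PathSearch.origin d n) : ℝ)) :=
  ⟨⟨12, by norm_num, fun _ _ _ hd => ⟨PathSearch.h_grid_le hd _ _ _, PathSearch.h_grid_le hd _ _ _,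
      PathSearch.h_grid_le hd _ _ _⟩⟩,
    fun _ _ _ hd hn => ⟨PathSearch.le_h_two_B hd hn _, PathSearch.le_h_two_A hd hn _⟩,
    fun _ _ _ hd hn => PathSearch.le_h_one_B hd hn⟩
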